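/- Let $\operatorname{Hilb}^2(\mathbb{Z})$ be the set of closed subschemes $Z\subset\mathbb{P}^2_{\mathbb{Z}}$ that are flat over $\mathbb{Z}$ and all of whose fibres over $\operatorname{Spec}\mathbb{Z}$ have dimension $0$ and degree $2$. Let $\ell\in\mathbb{Z}[X_0,X_1,X_2]$ be a primitive linear form and $q\in\mathbb{Z}[X_0,X_1,X_2]$ a quadratic form such that $X_0\ell,X_1\ell,X_2\ell,q$ span a primitive sublattice of the lattice of quadratic forms (a sublattice $\Lambda$ is primitive if $nx\in\Lambda$ with $n\in\mathbb{Z}\setminus\{0\}$ implies $x\in\Lambda$), and suppose that $Z\in\operatorname{Hilb}^2(\mathbb{Z})$ is defined by $\ell$ and $q$, i.e. $Z=\operatorname{Proj}\mathbb{Z}[X_0,X_1,X_2]/(\ell,q)$. Put $A=H^0(Z,\mathcal{O}_Z)$. A quadratic order is a commutative ring that is free of rank $2$ as a $\mathbb{Z}$-module. (1) If $v,w\in\mathbb{Z}^3$ is a basis of $\{x\in\mathbb{Z}^3:\ell(x)=0\}$, then $A$ is a quadratic order whose discriminant equals the discriminant $b^2-4ac$ of the binary form $q(Sv+Tw)=aS^2+bST+cT^2$,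 and every quadratic order with this discriminant is isomorphic to $A$. Write $\operatorname{Disc}(Z)$ for the discriminant of $A$. Call $Z$ nonreduced, respectively split, if the system $\ell(x)=q(x)=0$ has exactly one, respectively exactly two, nonzero rational solutions up to scaling, and nonsplit otherwise. (2) Suppose that $Z$ is split, and let $v,w\in\mathbb{Z}^3$ be linearly independent primitive vectors that solve $\ell(x)=q(x)=0$. Then $$\operatorname{Disc}(Z)=\gcd(v_1w_2-v_2w_1,\;v_2w_0-v_0w_2,\;v_0w_1-v_1w_0)^2.$$ (3) Suppose that $Z$ is nonsplit, put $\mathcal{D}=\operatorname{Disc}(Z)$, and let $v=(a_1+a_2\sqrt{\mathcal{D}},\,b_1+b_2\sqrt{\mathcal{D}},\,c_1+c_2\sqrt{\mathcal{D}})\in\mathbb{Z}[\sqrt{\mathcal{D}}]^3$ be a nonzero solution of $\ell(x)=q(x)=0$. Then there are a basis $e,f$ of $\{x\in\mathbb{Z}^3:\ell(x)=0\}$ and integers $g,\alpha,\beta$ with $(a_1,b_1,c_1)=g\,e$ and $(a_2,b_2,c_2)=\alpha e+\beta f$. For all such $e,f,g,\alpha,\beta$, the integer $\gcd(\beta^2\mathcal{D},\,2\alpha\beta\mathcal{D},\,g^2-\alpha^2\mathcal{D})$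 is nonzero and $$\operatorname{Disc}(Z)=\frac{4\beta^2g^2\mathcal{D}}{\gcd(\beta^2\mathcal{D},\,2\alpha\beta\mathcal{D},\,g^2-\alpha^2\mathcal{D})^2}.$$ -/

import Mathlib

open CategoryTheory AlgebraicGeometry

noncomputable section

namespace HilbTwo

/-! ### The quotient grading and the closed subscheme of the projective plane it defines -/

section QuotientGrading

variable {A : Type} [CommRing A] (𝒜 : ℕ → Submodule ℤ A) (I : Ideal A)

/-- The grading of `A ⧸ I` whose degree `n` piece is the image of the degree `n` piece of `A`. -/
def quotGrading (n : ℕ) : Submodule ℤ (A ⧸ I) :=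
  (𝒜 n).map (Ideal.Quotient.mkₐ ℤ I).toLinearMap

/-- The quotient map on the pieces of degree `n`. -/
def quotPiece (n : ℕ) : 𝒜 n →+ quotGrading 𝒜 I n where
  toFun x := ⟨Ideal.Quotient.mk I x, x, x.2, rfl⟩
  map_zero' := Subtype.ext (map_zero _)
  map_add' _ _ := Subtype.ext (map_add _ _ _)

variable [GradedRing 𝒜]

/-- The class of `a`, decomposed into the classes of the homogeneous components of `a`. -/
def quotDecomposeAux : A →+ DirectSum ℕ (fun n => quotGrading 𝒜 I n) :=
  (DirectSum.map (quotPiece 𝒜 I)).comp (DirectSum.decomposeAddEquiv 𝒜).toAddMonoidHom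

lemma coe_quotDecomposeAux (a : A) (n : ℕ) :
    (quotDecomposeAux 𝒜 I a n : A ⧸ I) =
      Ideal.Quotient.mk I (DirectSum.decompose 𝒜 a n : A) := by
  rfl

/-- The decomposition of the quotient by a homogeneous ideal. -/
def quotDecompose (hI : I.IsHomogeneous 𝒜) :
    A ⧸ I →+ DirectSum ℕ (fun n => quotGrading 𝒜 I n) :=
  QuotientAddGroup.lift _ (quotDecomposeAux 𝒜 I) (fun a ha => by
    refine DFinsupp.ext fun n => Subtype.ext ?_
    refine (coe_quotDecomposeAux 𝒜 I a n).trans ?_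
    exact Ideal.Quotient.eq_zero_iff_mem.mpr (hI n ha))

/-- The quotient of a graded ring by a homogeneous ideal is a graded ring. -/
abbrev quotGradedRing (hI : I.IsHomogeneous 𝒜) : GradedRing (quotGrading 𝒜 I) where
  one_mem := ⟨1, SetLike.GradedOne.one_mem, map_one (Ideal.Quotient.mk I)⟩
  mul_mem := by
    rintro i j _ _ ⟨a, ha, rfl⟩ ⟨b, hb, rfl⟩
    exact ⟨a * b, SetLike.GradedMul.mul_mem ha hb, map_mul (Ideal.Quotient.mkₐ ℤ I) a b⟩
  decompose' := quotDecompose 𝒜 I hI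
  left_inv := by
    intro x
    obtain ⟨a, rfl⟩ := Ideal.Quotient.mk_surjective x
    change DirectSum.coeAddMonoidHom _ (quotDecomposeAux 𝒜 I a) = _
    induction a using DirectSum.Decomposition.inductionOn 𝒜 with
    | zero => simp
    | @homogeneous i m =>
      change DirectSum.coeAddMonoidHom _ (DirectSum.map (quotPiece 𝒜 I) (DirectSum.decompose 𝒜 (m : A))) = _
      rw [DirectSum.decompose_coe, DirectSum.map_of, DirectSum.coeAddMonoidHom_of]
      rfl
    | add m m' h h' => rw [map_add, map_add, h, h', map_add]
  right_inv := by
    intro x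
    induction x using DirectSum.induction_on with
    | zero => simp
    | of i y =>
      obtain ⟨_, a, ha, rfl⟩ := y
      rw [DirectSum.coeAddMonoidHom_of]
      change quotDecomposeAux 𝒜 I a = _
      change DirectSum.map (quotPiece 𝒜 I) (DirectSum.decompose 𝒜 a) = _
      rw [DirectSum.decompose_of_mem 𝒜 ha, DirectSum.map_of]
      rfl
    | add x y hx hy => rw [map_add, map_add, hx, hy]

end QuotientGrading

/-- The homogeneous forms of degree `d` in `X₀, X₁, X₂` with integer coefficients. -/
abbrev Form (d : ℕ) : Submodule ℤ (MvPolynomial (Fin 3) ℤ) :=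
  MvPolynomial.homogeneousSubmodule (Fin 3) ℤ d

instance formGraded : GradedRing Form := MvPolynomial.gradedAlgebra

/-- The projective plane over the integers. -/
abbrev P2 : Scheme.{0} := Proj Form

variable (ℓ : Form 1) (q : Form 2)

/-- The ideal of `ℤ[X₀, X₁, X₂]` generated by `ℓ` and `q`. -/
def idealOf : Ideal (MvPolynomial (Fin 3) ℤ) :=
  Ideal.span {(ℓ : MvPolynomial (Fin 3) ℤ), (q : MvPolynomial (Fin 3) ℤ)}

lemma idealOf_isHomogeneous : (idealOf ℓ q).IsHomogeneous Form := by
  refine Ideal.homogeneous_span _ _ ?_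
  rintro x (rfl | rfl)
  · exact ⟨1, ℓ.2⟩
  · exact ⟨2, q.2⟩

instance quotFormGraded : GradedRing (quotGrading Form (idealOf ℓ q)) :=
  quotGradedRing Form (idealOf ℓ q) (idealOf_isHomogeneous ℓ q)

/-- The scheme `Proj (ℤ[X₀, X₁, X₂] / (ℓ, q))`. -/
abbrev projOf : Scheme.{0} := Proj (quotGrading Form (idealOf ℓ q))

/-- The quotient map `ℤ[X₀, X₁, X₂] → ℤ[X₀, X₁, X₂] / (ℓ, q)` of graded rings. -/
def quotHom : GradedRingHom Form (quotGrading Form (idealOf ℓ q)) where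
  toRingHom := Ideal.Quotient.mk (idealOf ℓ q)
  map_mem := fun {_ x} hx => ⟨x, hx, rfl⟩

lemma irrelevant_le_map_quotHom :
    HomogeneousIdeal.irrelevant (quotGrading Form (idealOf ℓ q)) ≤
      (HomogeneousIdeal.irrelevant Form).map (quotHom ℓ q) := by
  refine (HomogeneousIdeal.toIdeal_irrelevant_le _).mpr ?_
  rintro i hi _ ⟨a, ha, rfl⟩
  exact Ideal.mem_map_of_mem (quotHom ℓ q) (HomogeneousIdeal.mem_irrelevant_of_mem Form hi ha)

/-- The morphism from `Proj (ℤ[X₀, X₁, X₂] / (ℓ, q))` to the projective plane. -/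
def projOfMap : projOf ℓ q ⟶ P2 := Proj.map (quotHom ℓ q) (irrelevant_le_map_quotHom ℓ q)

/-! ### Integral points of the Hilbert scheme of two points in the plane -/

/-- The degree of the fibre of `f` over `y`, for a fibre of dimension zero: the dimension of its
space of global functions over the residue field of `y`. -/
def fiberDegree {X Y : Scheme.{0}} (f : X ⟶ Y) (y : Y) : ℕ :=
  letI : Algebra (Y.residueField y) Γ(f.fiber y, ⊤) :=
    ((Scheme.ΓSpecIso (Y.residueField y)).inv ≫ (f.fiberToSpecResidueField y).appTop).hom.toAlgebra
  Module.finrank (Y.residueField y) Γ(f.fiber y, ⊤)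

/-- `i : Z ⟶ P2` is an integral point of the Hilbert scheme of two points in the plane: a closed
subscheme, flat over the integers, all of whose fibres over `Spec ℤ` have dimension `0` and
degree `2`. -/
structure IsHilbPoint {Z : Scheme.{0}} (i : Z ⟶ P2) : Prop where
  closed : IsClosedImmersion i
  flat : Flat (specZIsTerminal.from Z)
  dim_fiber (s : Spec (CommRingCat.of ℤ)) :
    topologicalKrullDim ((specZIsTerminal.from Z).fiber s) = 0
  degree_fiber (s : Spec (CommRingCat.of ℤ)) : fiberDegree (specZIsTerminal.from Z) s = 2

/-- The subscheme `i : Z ⟶ P2` is `Proj (ℤ[X₀, X₁, X₂] / (ℓ, q))`, as a subscheme of the plane. -/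
def IsDefinedBy {Z : Scheme.{0}} (i : Z ⟶ P2) : Prop :=
  ∃ e : Z ≅ projOf ℓ q, e.hom ≫ projOfMap ℓ q = i

/-! ### Lattices, vectors and forms -/

/-- A polynomial is primitive if its coefficients have no common factor. -/
def IsPrimitivePoly (p : MvPolynomial (Fin 3) ℤ) : Prop :=
  ∀ n : ℤ, (∀ m, n ∣ p.coeff m) → IsUnit n

/-- A lattice is primitive if it contains `x` as soon as it contains a nonzero multiple of `x`. -/
def IsPrimitiveLattice {M : Type*} [AddCommGroup M] (Λ : Submodule ℤ M) : Prop :=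
  ∀ (x : M) (n : ℤ), n ≠ 0 → n • x ∈ Λ → x ∈ Λ

/-- The lattice spanned by `X₀ ℓ, X₁ ℓ, X₂ ℓ, q`. -/
def latticeTwo : Submodule ℤ (MvPolynomial (Fin 3) ℤ) :=
  Submodule.span ℤ
    {MvPolynomial.X 0 * (ℓ : MvPolynomial (Fin 3) ℤ), MvPolynomial.X 1 * ℓ.1,
      MvPolynomial.X 2 * ℓ.1, q.1}

/-- An integer vector is primitive if its coordinates have no common factor. -/
def IsPrimitiveVec (v : Fin 3 → ℤ) : Prop :=
  ∀ n : ℤ, (∀ j, n ∣ v j) → IsUnit n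

/-- `x` solves the system `ℓ = q = 0`. -/
def IsSolution {R : Type*} [CommRing R] (x : Fin 3 → R) : Prop :=
  MvPolynomial.aeval x (ℓ : MvPolynomial (Fin 3) ℤ) = 0 ∧
    MvPolynomial.aeval x (q : MvPolynomial (Fin 3) ℤ) = 0

/-- `v, w` is a basis of the lattice of integer vectors on which `ℓ` vanishes. -/
def IsKernelBasis (v w : Fin 3 → ℤ) : Prop :=
  LinearIndependent ℤ ![v, w] ∧
    ∀ x : Fin 3 → ℤ, x ∈ Submodule.span ℤ {v, w} ↔
      MvPolynomial.aeval x (ℓ : MvPolynomial (Fin 3) ℤ) = 0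

/-- The binary form `p(S v + T w)`, where `S` and `T` are the variables `0` and `1`. -/
def restrictForm (p : MvPolynomial (Fin 3) ℤ) (v w : Fin 3 → ℤ) : MvPolynomial (Fin 2) ℤ :=
  MvPolynomial.aeval (fun j => MvPolynomial.X 0 * MvPolynomial.C (v j) +
    MvPolynomial.X 1 * MvPolynomial.C (w j)) p

/-- The discriminant `b ^ 2 - 4 a c` of the binary quadratic form `a S ^ 2 + b S T + c T ^ 2`. -/
def binaryDisc (p : MvPolynomial (Fin 2) ℤ) : ℤ :=
  p.coeff (Finsupp.single 0 1 + Finsupp.single 1 1) ^ 2 -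
    4 * p.coeff (Finsupp.single 0 2) * p.coeff (Finsupp.single 1 2)

/-- The greatest common divisor of three integers. -/
def gcd3 (a b c : ℤ) : ℤ := (Int.gcd a (Int.gcd b c) : ℤ)

/-- The points of the rational projective plane at which `ℓ` and `q` vanish. -/
def rationalPoints : Set (Projectivization ℚ (Fin 3 → ℚ)) :=
  {p | IsSolution ℓ q p.rep}

/-- There are exactly two rational solutions of `ℓ = q = 0` up to scaling. -/
def IsSplit : Prop := (rationalPoints ℓ q).encard = 2

/-- The number of rational solutions of `ℓ = q = 0` up to scaling is neither one nor two. -/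
def IsNonsplit : Prop := (rationalPoints ℓ q).encard ≠ 1 ∧ (rationalPoints ℓ q).encard ≠ 2

/-- `A` is a quadratic order (a commutative ring, free of rank two as a `ℤ`-module) of
discriminant `D`. -/
def IsQuadraticOrder (A : Type*) [CommRing A] (D : ℤ) : Prop :=
  Algebra.IsQuadraticExtension ℤ A ∧
    ∀ b : Module.Basis (Fin 2) ℤ A, Algebra.discr ℤ b = D

end HilbTwo

end

namespace HilbTwo

/-! ### Quadratic orders -/

/-! Since `ℓ` is primitive, a basis `v, w` of its kernel extends to a basis of ℤ³, and `p ↦ p(Sv +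
Tw)` identifies ℤ[X₀, X₁, X₂]/(ℓ) with ℤ[S, T] (`IsKernelBasis.exists_section`). So Z is the zero
scheme in the projective line of the restriction Q = aS² + bST + cT² of `q`, and Q ≠ 0 because
otherwise the generic fibre of Z would contain a line (`restrictHom_ne_zero`).

Functions on Z are glued from the charts S ≠ 0 and T ≠ 0. Besides constants there is one new
function θ, equal to cT/S on the first chart and to -b - aS/T on the second; it reflects H¹(ℙ¹,
O(-2)) = ℤ. It satisfies θ² + bθ + ac = 0, so A = ℤ[θ] has discriminant b² - 4ac
(`nonempty_quadraticAlgebra_ringEquiv_global`). The discriminant determines a quadratic order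
because θ may be translated by integers (`IsQuadraticOrder.nonempty_ringEquiv`).

Primitivity of the lattice says that Q has content 1 (`isUnit_of_dvd_of_isPrimitiveLattice`), so Q
is known up to sign as soon as its zeros are. In the split case, choose e = ±v and w = αe + βf: then
Q = ±T(βS - αT) has discriminant β², while v × w is ±β times the primitive vector e × f. In the
nonsplit case, the zero (g + α√D, β√D) makes (a, b, c) proportional to (β²D, -2αβD, α²D - g²). The
latter form is ±G·Q with G the gcd of its coefficients, and its discriminant is 4β²g²D; hence G²D =
4β²g²D (`nonsplit_disc`). -/

lemma quadraticAlgebra_basis_zero (p q : ℤ) : QuadraticAlgebra.basis p q 0 = ⟨1, 0⟩ := by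
  apply (QuadraticAlgebra.basis p q).repr.injective
  ext i; fin_cases i <;> simp

lemma quadraticAlgebra_basis_one (p q : ℤ) : QuadraticAlgebra.basis p q 1 = ⟨0, 1⟩ := by
  apply (QuadraticAlgebra.basis p q).repr.injective
  ext i; fin_cases i <;> simp

lemma trace_quadraticAlgebra (p q : ℤ) (z : QuadraticAlgebra ℤ p q) :
    Algebra.trace ℤ (QuadraticAlgebra ℤ p q) z = 2 * z.re + q * z.im := by
  rw [Algebra.trace_eq_matrix_trace (QuadraticAlgebra.basis p q), Matrix.trace_fin_two,
    Algebra.leftMulMatrix_eq_repr_mul, Algebra.leftMulMatrix_eq_repr_mul]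
  rw [quadraticAlgebra_basis_zero, quadraticAlgebra_basis_one]
  simp
  ring

lemma discr_quadraticAlgebra (p q : ℤ) (b : Module.Basis (Fin 2) ℤ (QuadraticAlgebra ℤ p q)) :
    Algebra.discr ℤ b = q ^ 2 + 4 * p := by
  rw [Algebra.discr_eq_discr _ b (QuadraticAlgebra.basis p q)]
  rw [Algebra.discr_def, Matrix.det_fin_two]
  simp only [Algebra.traceMatrix_apply, Algebra.traceForm_apply,
    quadraticAlgebra_basis_zero, quadraticAlgebra_basis_one,
    trace_quadraticAlgebra, QuadraticAlgebra.mk_mul_mk]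
  ring

lemma isQuadraticOrder_of_ringEquiv {B : Type*} [CommRing B] {p q : ℤ}
    (e : QuadraticAlgebra ℤ p q ≃+* B) : IsQuadraticOrder B (q ^ 2 + 4 * p) := by
  let e' : QuadraticAlgebra ℤ p q ≃ₐ[ℤ] B := AlgEquiv.ofRingEquiv (f := e) (fun n => by simp)
  refine ⟨{ toFree := Module.Free.of_equiv e'.toLinearEquiv, finrank_eq_two' := ?_ }, fun b => ?_⟩
  · rw [← e'.toLinearEquiv.finrank_eq, QuadraticAlgebra.finrank_eq_two]
  · rw [Algebra.discr_eq_discr_of_algEquiv _ e'.symm,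
      ← discr_quadraticAlgebra p q (b.map e'.symm.toLinearEquiv)]
    congr 1

/-- A ring with additive basis `1, θ`, where `θ ^ 2 = p + q θ`, is a quadratic algebra. -/
lemma ringEquiv_of_bijective {B : Type*} [CommRing B] {p q : ℤ} {θ : B}
    (hθ : θ * θ = p + q * θ)
    (hb : Function.Bijective fun x : ℤ × ℤ => (x.1 : B) + x.2 * θ) :
    Nonempty (QuadraticAlgebra ℤ p q ≃+* B) := by
  let f : QuadraticAlgebra ℤ p q →ₐ[ℤ] B := QuadraticAlgebra.lift ⟨θ, by simpa using hθ⟩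
  have hf (z) : f z = (z.re : B) + z.im * θ := by
    simp [f, QuadraticAlgebra.lift]
  refine ⟨RingEquiv.ofBijective f ⟨fun x y h => ?_, fun z => ?_⟩⟩
  · have := @hb.1 (x.re, x.im) (y.re, y.im) (by simpa [hf] using h)
    simp only [Prod.mk.injEq] at this
    exact QuadraticAlgebra.ext this.1 this.2
  · obtain ⟨⟨n, m⟩, h⟩ := hb.2 z
    exact ⟨⟨n, m⟩, by rw [hf]; exact h⟩

/-- The vector 1 is primitive: if 1 = g·u with g an integer, taking norms gives 1 = g²N(u), so g is
a unit. A Bézout relation between the coordinates of 1 then completes it to a basis `1, θ`. -/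
lemma IsQuadraticOrder.exists_bijective {B : Type*} [CommRing B] {D : ℤ}
    (h : IsQuadraticOrder B D) :
    ∃ (θ : B) (p q : ℤ), θ * θ = p + q * θ ∧
      Function.Bijective fun x : ℤ × ℤ => (x.1 : B) + x.2 * θ := by
  have := h.1
  let b : Module.Basis (Fin 2) ℤ B :=
    Module.finBasisOfFinrankEq ℤ B (Algebra.IsQuadraticExtension.finrank_eq_two ℤ B)
  have hrep (z : B) : z = b.repr z 0 * b 0 + b.repr z 1 * b 1 := by
    conv_lhs => rw [← b.sum_repr z]
    simp
  set x := b.repr 1 0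
  set y := b.repr 1 1
  have h1 : (1 : B) = x * b 0 + y * b 1 := hrep 1
  have hcop : IsCoprime x y := by
    rw [Int.isCoprime_iff_gcd_eq_one]
    obtain ⟨k, hk⟩ := Int.gcd_dvd_left x y
    obtain ⟨l, hl⟩ := Int.gcd_dvd_right x y
    have hu : (1 : B) = algebraMap ℤ B (Int.gcd x y : ℤ) * (k * b 0 + l * b 1) := by
      rw [h1]
      have hk' : (x : B) = (Int.gcd x y : ℤ) * k := by exact_mod_cast congrArg (Int.cast : ℤ → B) hk
      have hl' : (y : B) = (Int.gcd x y : ℤ) * l := by exact_mod_cast congrArg (Int.cast : ℤ → B) hl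
      rw [algebraMap_int_eq, Int.coe_castRingHom]
      linear_combination b 0 * hk' + b 1 * hl'
    have := congrArg (Algebra.norm ℤ) hu
    rw [map_one, map_mul, Algebra.norm_algebraMap_of_basis b] at this
    have hunit : IsUnit ((Int.gcd x y : ℤ)) := by
      apply isUnit_of_dvd_one
      rw [this]
      exact Dvd.dvd.mul_right (dvd_pow_self _ (by simp)) _
    simpa using Int.isUnit_iff_natAbs_eq.mp hunit
  obtain ⟨r, s, hrs⟩ := hcop
  have hB : (r : B) * x + s * y = 1 := by exact_mod_cast congrArg (Int.cast : ℤ → B) hrs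
  let θ : B := -s * b 0 + r * b 1
  have hbij : Function.Bijective fun x : ℤ × ℤ => (x.1 : B) + x.2 * θ := by
    constructor
    · rintro ⟨n, m⟩ ⟨n', m'⟩ hnm
      have key : (((n - n') * x - (m - m') * s : ℤ)) • b 0
          + ((n - n') * y + (m - m') * r : ℤ) • b 1 = 0 := by
        simp only [zsmul_eq_mul]
        push_cast
        simp only [θ] at hnm
        linear_combination hnm - (n - n' : B) * h1
      have := Fintype.linearIndependent_iff.mp b.linearIndependent
        ![((n - n') * x - (m - m') * s : ℤ), ((n - n') * y + (m - m') * r : ℤ)]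
        (by simpa using key)
      have e0 : (n - n') * x - (m - m') * s = 0 := this 0
      have e1 : (n - n') * y + (m - m') * r = 0 := this 1
      ext
      · simp; linear_combination r * e0 + s * e1 - (n - n') * hrs
      · simp; linear_combination -y * e0 + x * e1 - (m - m') * hrs
    · intro z
      refine ⟨(r * b.repr z 0 + s * b.repr z 1, x * b.repr z 1 - y * b.repr z 0), ?_⟩
      conv_rhs => rw [hrep z]
      simp only [θ]
      push_cast
      linear_combination (r * b.repr z 0 + s * b.repr z 1 : B) * h1 +
        (b.repr z 0 * b 0 + b.repr z 1 * b 1) * hB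
  obtain ⟨⟨p, q⟩, hpq⟩ := hbij.2 (θ * θ)
  exact ⟨θ, p, q, hpq.symm, hbij⟩

lemma IsQuadraticOrder.unique {B : Type*} [CommRing B] {D D' : ℤ}
    (h : IsQuadraticOrder B D) (h' : IsQuadraticOrder B D') : D = D' := by
  have := h.1
  let b : Module.Basis (Fin 2) ℤ B :=
    Module.finBasisOfFinrankEq ℤ B (Algebra.IsQuadraticExtension.finrank_eq_two ℤ B)
  rw [← h.2 b, ← h'.2 b]

/-- Quadratic orders are determined by their discriminants. -/
lemma IsQuadraticOrder.nonempty_ringEquiv {B : Type*} [CommRing B] {p q : ℤ}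
    (h : IsQuadraticOrder B (q ^ 2 + 4 * p)) : Nonempty (QuadraticAlgebra ℤ p q ≃+* B) := by
  obtain ⟨θ, p', q', hθ, hb⟩ := h.exists_bijective
  obtain ⟨e⟩ := ringEquiv_of_bijective hθ hb
  have hD := h.unique (isQuadraticOrder_of_ringEquiv e)
  -- The discriminant q² + 4p fixes the parity of q, and replacing θ by θ + k changes the linear
  -- coefficient by 2k.
  have h2 : (2 : ℤ) ∣ q - q' := by
    have : Even ((q - q') * (q + q')) := ⟨2 * (p' - p), by linear_combination hD⟩
    rw [Int.even_mul] at this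
    rcases this with h | h
    · exact h.two_dvd
    · rw [Int.even_add] at h
      exact (Int.even_sub.mpr h).two_dvd
  obtain ⟨k, hk⟩ := h2
  obtain rfl : q = q' + 2 * k := by linear_combination hk
  obtain rfl : p' = p + q' * k + k ^ 2 := by linarith
  refine ringEquiv_of_bijective (θ := θ + k) ?_ ?_
  · push_cast at hθ ⊢
    linear_combination hθ
  · convert hb.comp (f := fun x : ℤ × ℤ => (x.1 + x.2 * k, x.2)) ⟨?_, ?_⟩ using 1
    · ext x; simp; ring
    · rintro ⟨a, b⟩ ⟨c, d⟩ h
      simp only [Prod.mk.injEq] at h ⊢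
      obtain ⟨h1, rfl⟩ := h
      exact ⟨by linarith, rfl⟩
    · rintro ⟨a, b⟩
      exact ⟨(a - b * k, b), by simp⟩


/-! ### Global functions on `Proj` from two standard charts -/

/-- `T` and `W` are tied to `U` and `V` only by equations, so that gluing applies directly to `⊤`
and to `D₊(s t)`. -/
lemma exists_section_of_agree (X : Scheme.{0}) {T U V W : X.Opens} (hT : T = U ⊔ V)
    (hW : W = U ⊓ V) (a : Γ(X, U)) (b : Γ(X, V))
    (h : X.presheaf.map (homOfLE (hW.trans_le inf_le_left)).op a =
      X.presheaf.map (homOfLE (hW.trans_le inf_le_right)).op b) :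
    ∃ x : Γ(X, T), X.presheaf.map (homOfLE (le_sup_left.trans hT.ge)).op x = a ∧
      X.presheaf.map (homOfLE (le_sup_right.trans hT.ge)).op x = b := by
  subst hT hW
  exact ⟨(X.sheaf.objSupIsoProdEqLocus U V).inv ⟨(a, b), h⟩,
    X.sheaf.objSupIsoProdEqLocus_inv_fst U V _, X.sheaf.objSupIsoProdEqLocus_inv_snd U V _⟩

section Charts

variable {A : Type} [CommRing A] (𝒜 : ℕ → Submodule ℤ A) [GradedRing 𝒜] {s t : A}

/-- Restriction of global functions on `Proj 𝒜` to the chart `D₊(s)`. -/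
noncomputable def chartHom (hs : s ∈ 𝒜 1) :
    Γ(Proj 𝒜, ⊤) →+* HomogeneousLocalization.Away 𝒜 s :=
  (Proj.basicOpenIsoAway 𝒜 s hs one_pos).inv.hom.comp
    ((Proj 𝒜).presheaf.map (homOfLE (le_top : Proj.basicOpen 𝒜 s ≤ ⊤)).op).hom

lemma awayToSection_chartHom (hs : s ∈ 𝒜 1) (x : Γ(Proj 𝒜, ⊤)) :
    Proj.awayToSection 𝒜 s (chartHom 𝒜 hs x) =
      (Proj 𝒜).presheaf.map (homOfLE (le_top : Proj.basicOpen 𝒜 s ≤ ⊤)).op x := by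
  have := (Proj.basicOpenIsoAway 𝒜 s hs one_pos).inv_hom_id
  rw [Proj.basicOpenIsoAway_hom] at this
  exact congr($(this) ((Proj 𝒜).presheaf.map (homOfLE le_top).op x))

lemma awayToSection_injective {m : ℕ} (hm : 0 < m) (hs : s ∈ 𝒜 m) :
    Function.Injective (Proj.awayToSection 𝒜 s) := by
  intro x y h
  have := (Proj.basicOpenIsoAway 𝒜 s hs hm).hom_inv_id
  rw [Proj.basicOpenIsoAway_hom] at this
  have hx := congr($(this) x)
  have hy := congr($(this) y)
  exact hx.symm.trans ((congrArg _ h).trans hy)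

lemma awayToSection_awayMap {g z : A} (hg : g ∈ 𝒜 1) (hz : z = s * g)
    (u : HomogeneousLocalization.Away 𝒜 s) :
    Proj.awayToSection 𝒜 z (HomogeneousLocalization.awayMap 𝒜 hg hz u) =
      (Proj 𝒜).presheaf.map (homOfLE (Proj.basicOpen_mono 𝒜 _ _ ⟨_, hz⟩)).op
        (Proj.awayToSection 𝒜 s u) :=
  congr($(Proj.awayMap_awayToSection 𝒜 hg hz) u)

/-- With the next two lemmas, this presents the global functions as the pairs of functions on
`D₊(s)` and `D₊(t)` that agree on `D₊(s t)`. -/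
lemma chartHom_agree (hs : s ∈ 𝒜 1) (ht : t ∈ 𝒜 1) (x : Γ(Proj 𝒜, ⊤)) :
    HomogeneousLocalization.awayMap 𝒜 ht rfl (chartHom 𝒜 hs x) =
      HomogeneousLocalization.awayMap 𝒜 hs (mul_comm s t) (chartHom 𝒜 ht x) := by
  apply awayToSection_injective 𝒜 two_pos (SetLike.mul_mem_graded hs ht)
  rw [awayToSection_awayMap, awayToSection_awayMap, awayToSection_chartHom,
    awayToSection_chartHom]
  simp only [← CommRingCat.comp_apply, ← Functor.map_comp, ← op_comp, homOfLE_comp]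

lemma eq_of_chartHom_eq (hcov : Proj.basicOpen 𝒜 s ⊔ Proj.basicOpen 𝒜 t = ⊤)
    (hs : s ∈ 𝒜 1) (ht : t ∈ 𝒜 1) {x y : Γ(Proj 𝒜, ⊤)}
    (h₁ : chartHom 𝒜 hs x = chartHom 𝒜 hs y) (h₂ : chartHom 𝒜 ht x = chartHom 𝒜 ht y) :
    x = y := by
  refine (Proj 𝒜).sheaf.eq_of_locally_eq₂ (homOfLE (le_top : Proj.basicOpen 𝒜 s ≤ ⊤))
    (homOfLE (le_top : Proj.basicOpen 𝒜 t ≤ ⊤)) hcov.ge _ _ ?_ ?_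
  · exact (awayToSection_chartHom 𝒜 hs x).symm.trans
      ((congrArg _ h₁).trans (awayToSection_chartHom 𝒜 hs y))
  · exact (awayToSection_chartHom 𝒜 ht x).symm.trans
      ((congrArg _ h₂).trans (awayToSection_chartHom 𝒜 ht y))

lemma exists_chartHom_eq (hcov : Proj.basicOpen 𝒜 s ⊔ Proj.basicOpen 𝒜 t = ⊤)
    (hs : s ∈ 𝒜 1) (ht : t ∈ 𝒜 1) (u : HomogeneousLocalization.Away 𝒜 s)
    (w : HomogeneousLocalization.Away 𝒜 t)
    (h : HomogeneousLocalization.awayMap 𝒜 ht rfl u =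
      HomogeneousLocalization.awayMap 𝒜 hs (mul_comm s t) w) :
    ∃ x, chartHom 𝒜 hs x = u ∧ chartHom 𝒜 ht x = w := by
  obtain ⟨x, hx₁, hx₂⟩ := exists_section_of_agree (Proj 𝒜) hcov.symm
    (Proj.basicOpen_mul 𝒜 s t) (Proj.awayToSection 𝒜 s u) (Proj.awayToSection 𝒜 t w) (by
      rw [← awayToSection_awayMap 𝒜 ht rfl, h, ← awayToSection_awayMap 𝒜 hs (mul_comm s t)])
  refine ⟨x, awayToSection_injective 𝒜 one_pos hs ?_, awayToSection_injective 𝒜 one_pos ht ?_⟩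
  · rw [awayToSection_chartHom]; exact hx₁
  · rw [awayToSection_chartHom]; exact hx₂

/-- The fraction `f / s ^ n` of degree zero. -/
noncomputable def frac (hs : s ∈ 𝒜 1) (n : ℕ) (f : A) (hf : f ∈ 𝒜 n) :
    HomogeneousLocalization.Away 𝒜 s :=
  HomogeneousLocalization.Away.mk 𝒜 hs n f (by simpa using hf)

variable {𝒜}

lemma algebraMap_pow_mul_val_frac (hs : s ∈ 𝒜 1) (n : ℕ) (f : A) (hf : f ∈ 𝒜 n) :
    algebraMap A (Localization.Away s) s ^ n * (frac 𝒜 hs n f hf).val = algebraMap A _ f := by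
  rw [frac, HomogeneousLocalization.Away.val_mk, ← map_pow, mul_comm]
  rw [Localization.mk_eq_mk'_apply]
  exact IsLocalization.mk'_spec (Localization.Away s) f (⟨s ^ n, n, rfl⟩ : Submonoid.powers s)

/-- Clearing denominators turns equalities of degree-zero fractions into ring identities in
`Localization.Away s`. -/
lemma eq_frac_iff (hs : s ∈ 𝒜 1) (n : ℕ) (f : A) (hf : f ∈ 𝒜 n)
    (u : HomogeneousLocalization.Away 𝒜 s) :
    u = frac 𝒜 hs n f hf ↔
      algebraMap A (Localization.Away s) s ^ n * u.val = algebraMap A _ f := by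
  rw [← algebraMap_pow_mul_val_frac hs n f hf, HomogeneousLocalization.ext_iff_val,
    ((IsLocalization.Away.algebraMap_isUnit s).pow n).mul_right_inj]

/-- Every large exponent is allowed, so that fractions on two charts can be given the same one. -/
lemma exists_eq_frac (hs : s ∈ 𝒜 1) (u : HomogeneousLocalization.Away 𝒜 s) :
    ∃ n, ∀ k, n ≤ k → ∃ f hf, u = frac 𝒜 hs k f hf := by
  obtain ⟨n, f, hf, rfl⟩ := HomogeneousLocalization.Away.mk_surjective 𝒜 hs u
  have hf' : f ∈ 𝒜 n := by simpa using hf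
  refine ⟨n, fun k hk => ?_⟩
  obtain ⟨j, rfl⟩ := Nat.exists_eq_add_of_le hk
  have hj : s ^ j * f ∈ 𝒜 (n + j) := by
    simpa [add_comm] using SetLike.mul_mem_graded (SetLike.pow_mem_graded j hs) hf'
  refine ⟨s ^ j * f, hj, ?_⟩
  rw [eq_frac_iff, map_mul, ← algebraMap_pow_mul_val_frac hs n f hf', map_pow]
  change _ * (frac 𝒜 hs n f hf').val = _
  ring

lemma algebraMap_away_eq_iff (x y : A) :
    algebraMap A (Localization.Away s) x = algebraMap A _ y ↔ ∃ k, s ^ k * x = s ^ k * y := by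
  rw [IsLocalization.eq_iff_exists (Submonoid.powers s)]
  constructor
  · rintro ⟨⟨_, k, rfl⟩, h⟩; exact ⟨k, h⟩
  · rintro ⟨k, h⟩; exact ⟨⟨_, k, rfl⟩, h⟩

lemma awayMap_frac (hs : s ∈ 𝒜 1) {g z : A} (hg : g ∈ 𝒜 1) (hz : z = s * g) (n : ℕ) (f : A)
    (hf : f ∈ 𝒜 n) :
    algebraMap A (Localization.Away z) z ^ n *
      (HomogeneousLocalization.awayMap 𝒜 hg hz (frac 𝒜 hs n f hf)).val =
        algebraMap A _ (f * g ^ n) := by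
  rw [frac, HomogeneousLocalization.awayMap_mk, HomogeneousLocalization.Away.val_mk,
    ← map_pow, mul_comm, Localization.mk_eq_mk'_apply]
  exact IsLocalization.mk'_spec (Localization.Away z) _ (⟨z ^ n, n, rfl⟩ : Submonoid.powers z)

/-- Two fractions with the same exponent agree on the overlap of two charts. -/
lemma awayMap_frac_eq_iff (hs : s ∈ 𝒜 1) (ht : t ∈ 𝒜 1) (n : ℕ) (f g : A)
    (hf : f ∈ 𝒜 n) (hg : g ∈ 𝒜 n) :
    HomogeneousLocalization.awayMap 𝒜 ht rfl (frac 𝒜 hs n f hf) =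
      HomogeneousLocalization.awayMap 𝒜 hs (mul_comm s t) (frac 𝒜 ht n g hg) ↔
    ∃ k, (s * t) ^ k * (f * t ^ n) = (s * t) ^ k * (g * s ^ n) := by
  rw [HomogeneousLocalization.ext_iff_val, ← algebraMap_away_eq_iff,
    ← awayMap_frac hs ht rfl n f hf, ← awayMap_frac ht hs (mul_comm s t) n g hg,
    ((IsLocalization.Away.algebraMap_isUnit (s * t)).pow n).mul_right_inj]

end Charts

/-! ### Binary quadratic forms and the syzygies of their powers -/

section BinaryForms

open MvPolynomial

/-- The binary quadratic form `a S ^ 2 + b S T + c T ^ 2`. -/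
noncomputable def binForm (a b c : ℤ) : MvPolynomial (Fin 2) ℤ :=
  C a * X 0 ^ 2 + C b * (X 0 * X 1) + C c * X 1 ^ 2

lemma binForm_isHomogeneous (a b c : ℤ) : (binForm a b c).IsHomogeneous 2 := by
  refine ((IsHomogeneous.C_mul ?_ _).add (IsHomogeneous.C_mul ?_ _)).add
    (IsHomogeneous.C_mul ?_ _)
  · exact isHomogeneous_X_pow 0 2
  · exact (isHomogeneous_X ℤ 0).mul (isHomogeneous_X ℤ 1)
  · exact isHomogeneous_X_pow 1 2

/-- Used to replace a cofactor in a homogeneous identity by its component of the right degree. -/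
lemma homogeneousComponent_mul_of_left {σ : Type*} {i : ℕ} {p : MvPolynomial σ ℤ}
    (hp : p.IsHomogeneous i) (j : ℕ) (r : MvPolynomial σ ℤ) :
    homogeneousComponent (i + j) (p * r) = p * homogeneousComponent j r := by
  let : GradedRing (homogeneousSubmodule σ ℤ) := gradedAlgebra
  have h := DirectSum.coe_decompose_mul_add_of_left_mem (homogeneousSubmodule σ ℤ) (i := i)
    (j := j) (a := p) (b := r) hp
  rw [← decomposition.decompose'_apply, ← decomposition.decompose'_apply]
  exact h

lemma X_pow_dvd_of_mul_eq {i j : Fin 2} (hij : i ≠ j) {k l : ℕ} {p r : MvPolynomial (Fin 2) ℤ}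
    (h : p * X j ^ l = r * X i ^ k) : X i ^ k ∣ p := by
  have h1 : X i ^ k ∣ p * X j ^ l := ⟨r, by rw [h, mul_comm]⟩
  refine (X_prime (i := i)).pow_dvd_of_dvd_mul_right k (fun h2 => ?_) h1
  have := (X_prime (i := i) (R := ℤ)).dvd_of_dvd_pow h2
  rw [X_dvd_X] at this
  exact hij (by simpa using this)

/-- A binary form of degree `2 n + 2` splits into multiples of `S ^ (n + 2)` and `T ^ (n + 2)` and
a multiple of `(S T) ^ (n + 1)`. -/
lemma exists_split_of_isHomogeneous {n : ℕ} {H : MvPolynomial (Fin 2) ℤ}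
    (hH : H.IsHomogeneous (2 * n + 2)) :
    ∃ (H₁ H₂ : MvPolynomial (Fin 2) ℤ) (m : ℤ), H₁.IsHomogeneous n ∧ H₂.IsHomogeneous n ∧
      H = X 1 ^ (n + 2) * H₁ + X 0 ^ (n + 2) * H₂ + C m * (X 0 * X 1) ^ (n + 1) := by
  let M : Submodule ℤ (MvPolynomial (Fin 2) ℤ) :=
    { carrier := {p | ∃ (H₁ H₂ : MvPolynomial (Fin 2) ℤ) (m : ℤ), H₁.IsHomogeneous n ∧
        H₂.IsHomogeneous n ∧
        p = X 1 ^ (n + 2) * H₁ + X 0 ^ (n + 2) * H₂ + C m * (X 0 * X 1) ^ (n + 1)}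
      zero_mem' := ⟨0, 0, 0, isHomogeneous_zero .., isHomogeneous_zero .., by simp⟩
      add_mem' := by
        rintro _ _ ⟨a, b, m, ha, hb, rfl⟩ ⟨a', b', m', ha', hb', rfl⟩
        exact ⟨a + a', b + b', m + m', ha.add ha', hb.add hb', by rw [C_add]; ring⟩
      smul_mem' := by
        rintro z _ ⟨a, b, m, ha, hb, rfl⟩
        refine ⟨C z * a, C z * b, z * m, ha.C_mul z, hb.C_mul z, ?_⟩
        rw [smul_eq_C_mul, C_mul]; ring }
  suffices H ∈ M from this
  rw [H.as_sum]
  refine M.sum_mem fun d hd => ?_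
  have hdeg : d 0 + d 1 = 2 * n + 2 := by
    have := hH.degree_eq_sum_deg_support hd
    rw [this, Finset.sum_subset (Finset.subset_univ _) (by simp), Fin.sum_univ_two]
  have hmon : monomial d (coeff d H) = C (coeff d H) * (X 0 ^ d 0 * X 1 ^ d 1) := by
    rw [monomial_eq, Finsupp.prod_fintype _ _ (by simp), Fin.prod_univ_two]
  rw [hmon]
  -- Unless both exponents equal n + 1, one of them is at least n + 2. Divided by (ST)^(n+2), the
  -- exceptional monomial is 1/(ST), the generator of H¹(ℙ¹, O(-2)).
  rcases lt_trichotomy (d 0) (n + 1) with h | h | h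
  · refine ⟨C (coeff d H) * (X 0 ^ d 0 * X 1 ^ (d 1 - (n + 2))), 0, 0, IsHomogeneous.C_mul ?_ _,
      isHomogeneous_zero .., ?_⟩
    · convert (isHomogeneous_X_pow (R := ℤ) (0 : Fin 2) (d 0)).mul
        (isHomogeneous_X_pow 1 (d 1 - (n + 2))) using 1
      omega
    · conv_lhs => rw [show d 1 = n + 2 + (d 1 - (n + 2)) by omega, pow_add]
      simp; ring
  · refine ⟨0, 0, coeff d H, isHomogeneous_zero .., isHomogeneous_zero .., ?_⟩
    rw [h, show d 1 = n + 1 by omega]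
    simp [mul_pow]
  · refine ⟨0, C (coeff d H) * (X 0 ^ (d 0 - (n + 2)) * X 1 ^ (d 1)), 0, isHomogeneous_zero ..,
      IsHomogeneous.C_mul ?_ _, ?_⟩
    · convert (isHomogeneous_X_pow (R := ℤ) (0 : Fin 2) (d 0 - (n + 2))).mul
        (isHomogeneous_X_pow 1 (d 1)) using 1
      omega
    · conv_lhs => rw [show d 0 = n + 2 + (d 0 - (n + 2)) by omega, pow_add]
      simp; ring

/-- Cocycles with values in the functions on the zero locus of a binary quadratic form. -/
lemma exists_of_mul_pow_sub_mul_pow {a b c : ℤ} {N : ℕ} {F G H : MvPolynomial (Fin 2) ℤ}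
    (hF : F.IsHomogeneous (N + 2)) (hG : G.IsHomogeneous (N + 2))
    (h : F * X 1 ^ (N + 2) - G * X 0 ^ (N + 2) = binForm a b c * H) :
    ∃ (n m : ℤ) (U V : MvPolynomial (Fin 2) ℤ),
      F = C n * X 0 ^ (N + 2) + C (m * c) * (X 0 ^ (N + 1) * X 1) + binForm a b c * U ∧
      G = C (n - m * b) * X 1 ^ (N + 2) - C (m * a) * (X 0 * X 1 ^ (N + 1)) +
        binForm a b c * V := by
  have h' : F * X 1 ^ (N + 2) - G * X 0 ^ (N + 2) =
      binForm a b c * homogeneousComponent (2 * N + 2) H := by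
    have hL : (F * X 1 ^ (N + 2) - G * X 0 ^ (N + 2)).IsHomogeneous (2 + (2 * N + 2)) := by
      rw [show 2 + (2 * N + 2) = N + 2 + (N + 2) by omega]
      exact (hF.mul (isHomogeneous_X_pow (1 : Fin 2) (N + 2))).sub
        (hG.mul (isHomogeneous_X_pow (0 : Fin 2) (N + 2)))
    rw [← homogeneousComponent_mul_of_left (binForm_isHomogeneous a b c), ← h,
      homogeneousComponent_eq_self hL]
  obtain ⟨H₁, H₂, m, hH₁, hH₂, hH⟩ :=
    exists_split_of_isHomogeneous (homogeneousComponent_isHomogeneous (2 * N + 2) H)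
  rw [hH] at h'
  -- The terms with `H₁` and `H₂` are multiples of Q regular on one chart. In m·Q·(ST)^(N+1), the
  -- part from cT² is a multiple of T^(N+2) and the part from aS² + bST a multiple of S^(N+2); these
  -- are the two local expressions of mθ. What is left is a cocycle identity without Q, whose
  -- solutions are constants.
  set F' := F - binForm a b c * H₁ - C (m * c) * (X 0 ^ (N + 1) * X 1) with hF'
  set G' := G + binForm a b c * H₂ + C m * (C a * (X 0 * X 1 ^ (N + 1)) + C b * X 1 ^ (N + 2))
    with hG'
  have key : F' * X 1 ^ (N + 2) = G' * X 0 ^ (N + 2) := by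
    rw [hF', hG', C_mul]
    rw [binForm] at h' ⊢
    linear_combination h'
  have hF'h : F'.IsHomogeneous (N + 2) := by
    refine (hF.sub ?_).sub (IsHomogeneous.C_mul ?_ _)
    · rw [add_comm N 2]
      exact (binForm_isHomogeneous a b c).mul hH₁
    · exact (isHomogeneous_X_pow 0 (N + 1)).mul (isHomogeneous_X ℤ 1)
  obtain ⟨W, hW⟩ := X_pow_dvd_of_mul_eq (by decide) key
  have hW' : F' = X 0 ^ (N + 2) * C (coeff 0 W) := by
    rw [← homogeneousComponent_zero, ← homogeneousComponent_mul_of_left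
      (isHomogeneous_X_pow 0 (N + 2)), ← hW, add_zero, homogeneousComponent_eq_self hF'h]
  have hG'' : G' = X 1 ^ (N + 2) * C (coeff 0 W) := by
    have h0 : (X 0 ^ (N + 2) : MvPolynomial (Fin 2) ℤ) ≠ 0 := pow_ne_zero _ (X_ne_zero 0)
    apply mul_right_cancel₀ h0
    rw [← key, hW']; ring
  refine ⟨coeff 0 W, m, H₁, -H₂, ?_, ?_⟩
  · rw [hF'] at hW'
    linear_combination hW'
  · rw [hG'] at hG''
    simp only [C_mul, C_sub]
    linear_combination hG''

/-- Linear independence of 1 and θ, in numerators. Eliminating between the two divisibilities and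
cancelling Q puts m(ST)^k in the ideal (S^(k+1), T^(k+1)), so m = 0. Then n is a multiple of Q,
which has no constant term. -/
lemma eq_zero_of_binForm_dvd {a b c : ℤ} (hQ : binForm a b c ≠ 0) {n m : ℤ} {k : ℕ}
    (h₁ : binForm a b c ∣ X 0 ^ k * (C n * X 0 + C (m * c) * X 1))
    (h₂ : binForm a b c ∣ X 1 ^ k * (C (n - m * b) * X 1 - C (m * a) * X 0)) :
    n = 0 ∧ m = 0 := by
  obtain ⟨U, hU⟩ := h₁
  obtain ⟨V, hV⟩ := h₂
  have key : C m * (X 0 ^ k * X 1 ^ k) = U * X 1 ^ (k + 1) - V * X 0 ^ (k + 1) := by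
    apply mul_left_cancel₀ hQ
    simp only [C_mul, C_sub] at hU hV
    have e : binForm a b c * (U * X 1 ^ (k + 1) - V * X 0 ^ (k + 1)) =
      (binForm a b c * U) * X 1 ^ (k + 1) - (binForm a b c * V) * X 0 ^ (k + 1) := by ring
    rw [e, ← hU, ← hV, binForm]
    ring
  have hm : m = 0 := by
    have := congrArg (coeff (Finsupp.single 0 k + Finsupp.single 1 k)) key
    rw [coeff_sub, X_pow_eq_monomial, X_pow_eq_monomial, X_pow_eq_monomial, X_pow_eq_monomial,
      coeff_mul_monomial', coeff_mul_monomial', if_neg, if_neg, monomial_mul, coeff_C_mul,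
      coeff_monomial, if_pos rfl] at this
    · simpa using this
    · intro h; simpa using h 0
    · intro h; simpa using h 1
  subst hm
  refine ⟨?_, rfl⟩
  have key' : U * X 1 ^ (k + 1) = V * X 0 ^ (k + 1) := by
    rw [← sub_eq_zero, ← key]; simp
  obtain ⟨W, rfl⟩ := X_pow_dvd_of_mul_eq (by decide) key'
  have h0 : (X 0 ^ (k + 1) : MvPolynomial (Fin 2) ℤ) ≠ 0 := pow_ne_zero _ (X_ne_zero 0)
  have : C n = binForm a b c * W := by
    apply mul_left_cancel₀ h0
    simp only [zero_mul, C_0, add_zero] at hU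
    linear_combination hU
  have := congrArg constantCoeff this
  simpa [binForm] using this


end BinaryForms

/-! ### Global functions on the zero scheme of a binary quadratic form. -/

section GlobalFunctions

open MvPolynomial

variable {A : Type} [CommRing A] (𝒜 : ℕ → Submodule ℤ A) [GradedRing 𝒜]
  (π : MvPolynomial (Fin 2) ℤ →+* A)

/-- The standard charts cover `Proj` of a graded ring generated by two elements of degree one. -/
lemma basicOpen_sup_basicOpen_eq_top
    (hgr : ∀ n f, f ∈ 𝒜 n ↔ ∃ F : MvPolynomial (Fin 2) ℤ, F.IsHomogeneous n ∧ π F = f) :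
    Proj.basicOpen 𝒜 (π (X 0)) ⊔ Proj.basicOpen 𝒜 (π (X 1)) = ⊤ := by
  refine top_le_iff.mp fun x _ => ?_
  by_contra hx
  have hx' : ¬ (x ∈ Proj.basicOpen 𝒜 (π (X 0)) ∨ x ∈ Proj.basicOpen 𝒜 (π (X 1))) := hx
  simp only [Proj.mem_basicOpen, not_or, not_not] at hx'
  refine x.not_irrelevant_le ((HomogeneousIdeal.toIdeal_irrelevant_le _).mpr ?_)
  intro i hi f hf
  obtain ⟨F, hF, rfl⟩ := (hgr i f).mp hf
  change π F ∈ x.asHomogeneousIdeal.toIdeal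
  rw [F.as_sum, map_sum]
  refine Ideal.sum_mem _ fun d hd => ?_
  have hdeg : d 0 + d 1 = i := by
    have := hF.degree_eq_sum_deg_support hd
    rw [this, Finset.sum_subset (Finset.subset_univ _) (by simp), Fin.sum_univ_two]
  rw [monomial_eq, Finsupp.prod_fintype _ _ (by simp), Fin.prod_univ_two, map_mul, map_mul,
    map_pow, map_pow]
  refine Ideal.mul_mem_left _ _ ?_
  rcases Nat.eq_zero_or_pos (d 0) with h | h
  · exact Ideal.mul_mem_left _ _ (Ideal.pow_mem_of_mem _ hx'.2 _ (by omega))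
  · exact Ideal.mul_mem_right _ _ (Ideal.pow_mem_of_mem _ hx'.1 _ h)

/-- The global functions on the zero locus of a nonzero binary quadratic form in the projective
line. -/
theorem nonempty_quadraticAlgebra_ringEquiv_global {a b c : ℤ} (hQ : binForm a b c ≠ 0)
    (hgr : ∀ n f, f ∈ 𝒜 n ↔ ∃ F : MvPolynomial (Fin 2) ℤ, F.IsHomogeneous n ∧ π F = f)
    (hker : ∀ F, π F = 0 ↔ binForm a b c ∣ F) :
    Nonempty (QuadraticAlgebra ℤ (-(a * c)) (-b) ≃+* Γ(Proj 𝒜, ⊤)) := by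
  have hcov := basicOpen_sup_basicOpen_eq_top 𝒜 π hgr
  set s := π (X 0) with hs_def
  set t := π (X 1) with ht_def
  have hs : s ∈ 𝒜 1 := (hgr 1 s).mpr ⟨_, isHomogeneous_X ℤ 0, rfl⟩
  have ht : t ∈ 𝒜 1 := (hgr 1 t).mpr ⟨_, isHomogeneous_X ℤ 1, rfl⟩
  have hπC (n : ℤ) : π (C n) = n := by rw [← eq_intCast (π.comp C) n]; rfl
  have hrel : (a : A) * s ^ 2 + b * (s * t) + c * t ^ 2 = 0 := by
    have := (hker _).mpr (dvd_refl (binForm a b c))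
    simpa [binForm, hπC] using this
  have hct : (c : A) * t ∈ 𝒜 1 := by
    rw [← zsmul_eq_mul]; exact (𝒜 1).smul_mem c ht
  have hbt : (-b : A) * t - a * s ∈ 𝒜 1 := by
    rw [← Int.cast_neg, ← zsmul_eq_mul, ← zsmul_eq_mul]
    exact (𝒜 1).sub_mem ((𝒜 1).smul_mem _ ht) ((𝒜 1).smul_mem _ hs)
  -- θ is cT/S on one chart and (-bT - aS)/T on the other; the difference of the two is Q/(ST),
  -- which vanishes.
  obtain ⟨θ, hθs, hθt⟩ := exists_chartHom_eq 𝒜 hcov hs ht (frac 𝒜 hs 1 _ hct)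
    (frac 𝒜 ht 1 _ hbt) ((awayMap_frac_eq_iff hs ht 1 _ _ hct hbt).mpr
      ⟨0, by linear_combination hrel⟩)
  rw [eq_frac_iff, pow_one] at hθs hθt
  simp only [map_mul, map_sub, map_neg, map_intCast] at hθs hθt
  have hus := IsLocalization.Away.algebraMap_isUnit (S := Localization.Away s) s
  have hut := IsLocalization.Away.algebraMap_isUnit (S := Localization.Away t) t
  have hrels := congrArg (algebraMap A (Localization.Away s)) hrel
  have hrelt := congrArg (algebraMap A (Localization.Away t)) hrel
  simp only [map_mul, map_add, map_pow, map_intCast, map_zero] at hrels hrelt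
  refine ringEquiv_of_bijective (θ := θ) ?_ ⟨?_, ?_⟩
  · apply eq_of_chartHom_eq 𝒜 hcov hs ht <;> rw [HomogeneousLocalization.ext_iff_val] <;>
      simp only [map_mul, map_add, map_intCast, HomogeneousLocalization.val_mul,
        HomogeneousLocalization.val_add, HomogeneousLocalization.val_intCast] <;> push_cast
    · refine (hus.pow 2).mul_left_cancel ?_
      linear_combination (algebraMap A (Localization.Away s) s * (chartHom 𝒜 hs θ).val +
        c * algebraMap A (Localization.Away s) t + b * algebraMap A (Localization.Away s) s) * hθs
        + c * hrels
    · refine (hut.pow 2).mul_left_cancel ?_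
      linear_combination (algebraMap A (Localization.Away t) t * (chartHom 𝒜 ht θ).val
        - a * algebraMap A (Localization.Away t) s) * hθt
        + a * hrelt
  · have key (n m : ℤ) (h : (n : Γ(Proj 𝒜, ⊤)) + m * θ = 0) : n = 0 ∧ m = 0 := by
      have h₁ := congrArg HomogeneousLocalization.val (congrArg (chartHom 𝒜 hs) h)
      have h₂ := congrArg HomogeneousLocalization.val (congrArg (chartHom 𝒜 ht) h)
      simp only [map_mul, map_add, map_intCast, HomogeneousLocalization.val_mul,
        HomogeneousLocalization.val_add, HomogeneousLocalization.val_intCast, map_zero,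
        HomogeneousLocalization.val_zero] at h₁ h₂
      have e₁ : algebraMap A (Localization.Away s) (n * s + m * c * t) = algebraMap A _ 0 := by
        simp only [map_mul, map_add, map_intCast, map_zero]
        linear_combination algebraMap A (Localization.Away s) s * h₁ - m * hθs
      have e₂ : algebraMap A (Localization.Away t) ((n - m * b) * t - m * a * s) =
          algebraMap A _ 0 := by
        simp only [map_mul, map_sub, map_intCast, map_zero]
        linear_combination algebraMap A (Localization.Away t) t * h₂ - m * hθt
      obtain ⟨k, hk⟩ := (algebraMap_away_eq_iff _ _).mp e₁
      obtain ⟨l, hl⟩ := (algebraMap_away_eq_iff _ _).mp e₂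
      refine eq_zero_of_binForm_dvd hQ (k := k + l) ((hker _).mp ?_) ((hker _).mp ?_)
      · simp only [map_mul, map_add, map_pow, hπC, ← hs_def, ← ht_def]
        linear_combination s ^ l * hk
      · simp only [map_mul, map_sub, map_pow, hπC, ← hs_def, ← ht_def]
        linear_combination t ^ k * hl
    rintro ⟨n, m⟩ ⟨n', m'⟩ h
    obtain ⟨h₁, h₂⟩ := key (n - n') (m - m') (by
      simp only at h
      push_cast
      linear_combination h)
    simp only [Prod.mk.injEq]
    constructor <;> linarith
  · intro x
    obtain ⟨n₁, h₁⟩ := exists_eq_frac hs (chartHom 𝒜 hs x)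
    obtain ⟨n₂, h₂⟩ := exists_eq_frac ht (chartHom 𝒜 ht x)
    -- A common exponent for both charts; the 2 brings it to the form `N + 2` required of cocycles.
    obtain ⟨f, hf, hxf⟩ := h₁ (n₁ + n₂ + 2) (by omega)
    obtain ⟨g, hg, hxg⟩ := h₂ (n₁ + n₂ + 2) (by omega)
    have hag := chartHom_agree 𝒜 hs ht x
    rw [hxf, hxg, awayMap_frac_eq_iff] at hag
    obtain ⟨k, hk⟩ := hag
    rw [eq_frac_iff] at hxf hxg
    obtain ⟨F, hF, rfl⟩ := (hgr _ _).mp hf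
    obtain ⟨G, hG, rfl⟩ := (hgr _ _).mp hg
    -- The factor (ST)^k needed for agreement on the overlap is absorbed into numerators and
    -- denominators: the fractions become S^k F / S^(N+2) and T^k G / T^(N+2) with N = n₁ + n₂ + k.
    obtain ⟨H, hH⟩ := (hker (X 0 ^ k * F * X 1 ^ (n₁ + n₂ + k + 2) -
        X 1 ^ k * G * X 0 ^ (n₁ + n₂ + k + 2))).mp (by
      simp only [map_sub, map_mul, map_pow, ← hs_def, ← ht_def]
      linear_combination hk)
    obtain ⟨n, m, U, V, hU, hV⟩ := exists_of_mul_pow_sub_mul_pow (N := n₁ + n₂ + k)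
      (by convert (isHomogeneous_X_pow (0 : Fin 2) k).mul hF using 1; omega)
      (by convert (isHomogeneous_X_pow (1 : Fin 2) k).mul hG using 1; omega) hH
    have hQ0 : π (binForm a b c) = 0 := (hker _).mpr dvd_rfl
    have hU' := congrArg (fun p => algebraMap A (Localization.Away s) (π p)) hU
    have hV' := congrArg (fun p => algebraMap A (Localization.Away t) (π p)) hV
    simp only [map_mul, map_add, map_sub, map_pow, hπC, hQ0, ← hs_def, ← ht_def, ← hxf, ← hxg,
      map_intCast, map_zero] at hU' hV'
    refine ⟨(n, m), ?_⟩
    apply eq_of_chartHom_eq 𝒜 hcov hs ht <;> rw [HomogeneousLocalization.ext_iff_val] <;>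
      simp only [map_mul, map_add, map_intCast, HomogeneousLocalization.val_mul,
        HomogeneousLocalization.val_add, HomogeneousLocalization.val_intCast]
    · refine (hus.pow (n₁ + n₂ + k + 2)).mul_left_cancel ?_
      linear_combination m * algebraMap A (Localization.Away s) s ^ (n₁ + n₂ + k + 1) * hθs - hU'
    · refine (hut.pow (n₁ + n₂ + k + 2)).mul_left_cancel ?_
      linear_combination m * algebraMap A (Localization.Away t) t ^ (n₁ + n₂ + k + 1) * hθt - hV'

end GlobalFunctions

/-! ### Restriction of forms to the line `ℓ = 0` -/

section Restriction

open MvPolynomial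

lemma exists_eq_sum_of_form_one (ℓ : Form 1) :
    ∃ l : Fin 3 → ℤ, (ℓ : MvPolynomial (Fin 3) ℤ) = ∑ j, C (l j) * X j := by
  have h : (ℓ : MvPolynomial (Fin 3) ℤ) ∈ homogeneousSubmodule (Fin 3) ℤ 1 := ℓ.2
  rw [homogeneousSubmodule_one_eq_span_X, Submodule.mem_span_range_iff_exists_fun] at h
  obtain ⟨l, hl⟩ := h
  exact ⟨l, by simp_rw [← hl, smul_eq_C_mul]⟩

/-- A primitive linear form takes the value one. -/
lemma exists_aeval_eq_one {ℓ : Form 1} (hℓ : IsPrimitivePoly ℓ) :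
    ∃ u : Fin 3 → ℤ, aeval u (ℓ : MvPolynomial (Fin 3) ℤ) = 1 := by
  obtain ⟨l, hl⟩ := exists_eq_sum_of_form_one ℓ
  have h1 : (1 : ℤ) ∈ Ideal.span (Set.range l) := by
    obtain ⟨g, hg⟩ := IsPrincipalIdealRing.principal (Ideal.span (Set.range l))
    have hgl (j : Fin 3) : g ∣ l j := by
      have : l j ∈ Ideal.span (Set.range l) := Ideal.subset_span ⟨j, rfl⟩
      rw [hg] at this
      exact Ideal.mem_span_singleton.mp this
    have hu : IsUnit g := by
      refine hℓ g fun m => ?_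
      rw [hl, coeff_sum]
      exact Finset.dvd_sum fun j _ => by
        rw [coeff_C_mul]; exact (hgl j).mul_right _
    rw [hg]
    exact Ideal.mem_span_singleton.mpr hu.dvd
  obtain ⟨u, hu⟩ := (Ideal.mem_span_range_iff_exists_fun).mp h1
  refine ⟨u, ?_⟩
  rw [hl, ← hu]
  simp [mul_comm]

/-- The restriction of polynomials to the plane spanned by `v` and `w`. -/
noncomputable def restrictHom (v w : Fin 3 → ℤ) :
    MvPolynomial (Fin 3) ℤ →ₐ[ℤ] MvPolynomial (Fin 2) ℤ :=
  aeval fun j => X 0 * C (v j) + X 1 * C (w j)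

lemma restrictHom_isHomogeneous (v w : Fin 3 → ℤ) {n : ℕ} {p : MvPolynomial (Fin 3) ℤ}
    (hp : p.IsHomogeneous n) : (restrictHom v w p).IsHomogeneous n := by
  have := hp.eval₂ (n := 1) (algebraMap ℤ (MvPolynomial (Fin 2) ℤ))
    (fun j => X 0 * C (v j) + X 1 * C (w j)) (fun r => ?_) (fun j => ?_)
  · rwa [one_mul] at this
  · rw [eq_intCast, ← eq_intCast C]
    exact isHomogeneous_C _ _
  · exact ((isHomogeneous_X ℤ 0).mul (isHomogeneous_C _ _)).add
      ((isHomogeneous_X ℤ 1).mul (isHomogeneous_C _ _))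

lemma aeval_linear (l x : Fin 3 → ℤ) :
    aeval x (∑ j, C (l j) * X j : MvPolynomial (Fin 3) ℤ) = ∑ j, l j * x j := by
  simp

lemma restrictHom_linear (v w l : Fin 3 → ℤ) :
    restrictHom v w (∑ j, C (l j) * X j) = X 0 * C (∑ j, l j * v j) + X 1 * C (∑ j, l j * w j) := by
  simp only [restrictHom, map_sum, map_mul, aeval_X, algHom_C, algebraMap_eq, Finset.mul_sum,
    ← Finset.sum_add_distrib]
  exact Finset.sum_congr rfl fun _ _ => by ring

lemma IsKernelBasis.restrictHom_eq_zero {ℓ : Form 1} {v w : Fin 3 → ℤ}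
    (h : IsKernelBasis ℓ v w) : restrictHom v w ℓ = 0 := by
  obtain ⟨l, hl⟩ := exists_eq_sum_of_form_one ℓ
  have hv := (h.2 v).mp (Submodule.subset_span (by simp))
  have hw := (h.2 w).mp (Submodule.subset_span (by simp))
  rw [hl, aeval_linear] at hv hw
  rw [hl, restrictHom_linear, hv, hw]
  simp

lemma IsKernelBasis.eq_and_eq {ℓ : Form 1} {v w : Fin 3 → ℤ} (h : IsKernelBasis ℓ v w)
    {a b a' b' : ℤ} (heq : ∀ j, a * v j + b * w j = a' * v j + b' * w j) : a = a' ∧ b = b' := by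
  have := Fintype.linearIndependent_iff.mp h.1 ![a - a', b - b'] (by
    ext j
    have := heq j
    simp only [Fin.sum_univ_two, Matrix.cons_val_zero, Matrix.cons_val_one, Pi.add_apply,
      Pi.smul_apply, smul_eq_mul, Pi.zero_apply]
    linear_combination this)
  have h0 : a - a' = 0 := this 0
  have h1 : b - b' = 0 := this 1
  exact ⟨by linarith, by linarith⟩

/-- Completion of a kernel basis to a basis `v, w, u`, with the coordinates `σ, τ, l` dual to it. -/
lemma IsKernelBasis.exists_dual {ℓ : Form 1} (hℓ : IsPrimitivePoly ℓ) {v w : Fin 3 → ℤ}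
    (h : IsKernelBasis ℓ v w) :
    ∃ l u σ τ : Fin 3 → ℤ, (ℓ : MvPolynomial (Fin 3) ℤ) = ∑ j, C (l j) * X j ∧
      ∀ j i, σ j * v i + τ j * w i = (Pi.single j 1 : Fin 3 → ℤ) i - l j * u i := by
  obtain ⟨u, hu⟩ := exists_aeval_eq_one hℓ
  obtain ⟨l, hl⟩ := exists_eq_sum_of_form_one ℓ
  have hex (j : Fin 3) : ∃ a b : ℤ, ∀ i,
      a * v i + b * w i = (Pi.single j 1 : Fin 3 → ℤ) i - l j * u i := by
    -- As ℓ(u) = 1, subtracting ℓ(x)u projects any vector x onto the kernel; here x is the j-th unit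
    -- vector.
    have : (fun i => (Pi.single j 1 : Fin 3 → ℤ) i - l j * u i) ∈ Submodule.span ℤ {v, w} := by
      rw [h.2, hl, aeval_linear]
      rw [hl, aeval_linear] at hu
      simp only [mul_sub, Finset.sum_sub_distrib]
      rw [show ∑ x, l x * (l j * u x) = l j * ∑ x, l x * u x by
        rw [Finset.mul_sum]; exact Finset.sum_congr rfl fun _ _ => by ring, hu]
      simp [Pi.single_apply]
    obtain ⟨a, b, hab⟩ := Submodule.mem_span_pair.mp this
    exact ⟨a, b, fun i => by simpa using congrFun hab i⟩
  choose σ τ hστ using hex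
  exact ⟨l, u, σ, τ, hl, hστ⟩

/-- The inclusion of the coordinate ring of the line `ℓ = 0` given by a complement. -/
lemma IsKernelBasis.exists_section {ℓ : Form 1} (hℓ : IsPrimitivePoly ℓ) {v w : Fin 3 → ℤ}
    (h : IsKernelBasis ℓ v w) :
    ∃ (φ : MvPolynomial (Fin 2) ℤ →ₐ[ℤ] MvPolynomial (Fin 3) ℤ),
      (∀ n F, IsHomogeneous F n → (φ F).IsHomogeneous n) ∧
      (∀ F, restrictHom v w (φ F) = F) ∧
      ∀ p, (ℓ : MvPolynomial (Fin 3) ℤ) ∣ p - φ (restrictHom v w p) := by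
  obtain ⟨l, u, σ, τ, hl, hστ⟩ := h.exists_dual hℓ
  have hlx (x : Fin 3 → ℤ) : aeval x (ℓ : MvPolynomial (Fin 3) ℤ) = ∑ j, l j * x j := by
    rw [hl, aeval_linear]
  have hexp (x : Fin 3 → ℤ) (hx : ∑ j, l j * x j = 0) (i : Fin 3) :
      (∑ j, σ j * x j) * v i + (∑ j, τ j * x j) * w i = x i := by
    have : ∑ j, x j * (σ j * v i + τ j * w i) = x i - (∑ j, l j * x j) * u i := by
      simp only [hστ, mul_sub, Finset.sum_sub_distrib, Finset.sum_mul]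
      congr 1
      · simp [Pi.single_apply]
      · exact Finset.sum_congr rfl fun _ _ => by ring
    rw [hx, zero_mul, sub_zero] at this
    rw [← this, Finset.sum_mul, Finset.sum_mul, ← Finset.sum_add_distrib]
    exact Finset.sum_congr rfl fun _ _ => by ring
  have hv := (h.2 v).mp (Submodule.subset_span (by simp))
  have hw := (h.2 w).mp (Submodule.subset_span (by simp))
  rw [hlx] at hv hw
  obtain ⟨σv, τv⟩ := h.eq_and_eq (a' := 1) (b' := 0) fun j => by simpa using hexp v hv j
  obtain ⟨σw, τw⟩ := h.eq_and_eq (a' := 0) (b' := 1) fun j => by simpa using hexp w hw j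
  let f : Fin 2 → MvPolynomial (Fin 3) ℤ := ![∑ j, C (σ j) * X j, ∑ j, C (τ j) * X j]
  have hf (i) : (f i).IsHomogeneous 1 := by
    have (r : Fin 3 → ℤ) : (∑ j, C (r j) * X j : MvPolynomial (Fin 3) ℤ).IsHomogeneous 1 :=
      IsHomogeneous.sum _ _ _ fun j _ => isHomogeneous_C_mul_X _ _
    fin_cases i
    · exact this σ
    · exact this τ
  refine ⟨aeval f, fun n F hF => by simpa using hF.aeval f hf, fun F => ?_, fun p => ?_⟩
  · have : (restrictHom v w).comp (aeval f) = AlgHom.id ℤ _ := by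
      refine algHom_ext fun i => ?_
      fin_cases i
      · simp only [AlgHom.comp_apply, aeval_X]
        refine (restrictHom_linear v w σ).trans ?_
        rw [σv, σw]; simp
      · simp only [AlgHom.comp_apply, aeval_X]
        refine (restrictHom_linear v w τ).trans ?_
        rw [τv, τw]; simp
    exact congr($this F)
  · rw [← Ideal.mem_span_singleton, ← Ideal.Quotient.mk_eq_mk_iff_sub_mem]
    set I := Ideal.span {(ℓ : MvPolynomial (Fin 3) ℤ)}
    have : Ideal.Quotient.mkₐ ℤ I =
        (Ideal.Quotient.mkₐ ℤ I).comp ((aeval f).comp (restrictHom v w)) := by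
      refine algHom_ext fun i => ?_
      rw [Ideal.Quotient.mkₐ_eq_mk, AlgHom.comp_apply, Ideal.Quotient.mkₐ_eq_mk,
        Ideal.Quotient.mk_eq_mk_iff_sub_mem, Ideal.mem_span_singleton]
      -- Restricting Xᵢ and lifting back gives σ(X)vᵢ + τ(X)wᵢ = Xᵢ - uᵢℓ, by duality of the two
      -- bases.
      refine ⟨C (u i), ?_⟩
      rw [hl]
      have e0 := congrArg (C (σ := Fin 3)) (hστ 0 i)
      have e1 := congrArg (C (σ := Fin 3)) (hστ 1 i)
      have e2 := congrArg (C (σ := Fin 3)) (hστ 2 i)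
      simp only [C_add, C_mul, C_sub] at e0 e1 e2
      have hX : (X i : MvPolynomial (Fin 3) ℤ) = C ((Pi.single 0 1 : Fin 3 → ℤ) i) * X 0 +
        C ((Pi.single 1 1 : Fin 3 → ℤ) i) * X 1 + C ((Pi.single 2 1 : Fin 3 → ℤ) i) * X 2 := by
        fin_cases i <;> simp
      rw [AlgHom.comp_apply]
      simp only [f, restrictHom, Fin.sum_univ_three, aeval_X, map_add, map_mul, algHom_C,
        Matrix.cons_val_zero, Matrix.cons_val_one, algebraMap_eq]
      linear_combination hX - X 0 * e0 - X 1 * e1 - X 2 * e2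
    exact congr($this p)

/-- Binary forms of degree two in terms of their coefficients. -/
lemma eq_binForm_of_isHomogeneous {Q : MvPolynomial (Fin 2) ℤ} (hQ : Q.IsHomogeneous 2) :
    Q = binForm (Q.coeff (Finsupp.single 0 2))
      (Q.coeff (Finsupp.single 0 1 + Finsupp.single 1 1)) (Q.coeff (Finsupp.single 1 2)) := by
  obtain ⟨H₁, H₂, m, h₁, h₂, h⟩ := exists_split_of_isHomogeneous (n := 0) hQ
  obtain ⟨r, rfl⟩ : ∃ r, H₁ = C r := ⟨_, totalDegree_eq_zero_iff_eq_C.mp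
    (Nat.le_zero.mp h₁.totalDegree_le)⟩
  obtain ⟨r', rfl⟩ : ∃ r, H₂ = C r := ⟨_, totalDegree_eq_zero_iff_eq_C.mp
    (Nat.le_zero.mp h₂.totalDegree_le)⟩
  have hb : Q = binForm r' m r := by rw [h, binForm]; ring
  have hm : binForm r' m r = monomial (Finsupp.single 0 2) r' +
      monomial (Finsupp.single 0 1 + Finsupp.single 1 1) m + monomial (Finsupp.single 1 2) r := by
    rw [binForm, X_pow_eq_monomial, X_pow_eq_monomial, C_mul_monomial, C_mul_monomial, X, X,
      monomial_mul, C_mul_monomial]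
    simp only [mul_one]
  have n1 : (Finsupp.single 0 1 + Finsupp.single 1 1 : Fin 2 →₀ ℕ) ≠ Finsupp.single 0 2 :=
    fun h => by simpa using congr($h 1)
  have n2 : (Finsupp.single 1 2 : Fin 2 →₀ ℕ) ≠ Finsupp.single 0 2 :=
    fun h => by simpa using congr($h 1)
  have n3 : (Finsupp.single 0 1 + Finsupp.single 1 1 : Fin 2 →₀ ℕ) ≠ Finsupp.single 1 2 :=
    fun h => by simpa using congr($h 0)
  conv_lhs => rw [hb]
  congr 1 <;> rw [hb, hm] <;> simp only [coeff_add, coeff_monomial] <;>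
    simp [n1, n2, n3, n1.symm, n2.symm, n3.symm]

end Restriction

/-! ### Z as a zero scheme in the projective line, and nonvanishing of the restricted form. -/

section ProjOf

open MvPolynomial

/-- The functions on `Proj (ℤ[X₀, X₁, X₂] / (ℓ, q))` form the quadratic algebra attached to the
restriction of `q` to the line `ℓ = 0`. -/
theorem nonempty_quadraticAlgebra_ringEquiv_projOf {ℓ : Form 1} {q : Form 2}
    (hℓ : IsPrimitivePoly ℓ) {v w : Fin 3 → ℤ} (h : IsKernelBasis ℓ v w) {a b c : ℤ}
    (hq : restrictHom v w q = binForm a b c) (hQ : binForm a b c ≠ 0) :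
    Nonempty (QuadraticAlgebra ℤ (-(a * c)) (-b) ≃+* Γ(projOf ℓ q, ⊤)) := by
  obtain ⟨φ, hφh, hφ, hφℓ⟩ := h.exists_section hℓ
  have hℓI : (ℓ : MvPolynomial (Fin 3) ℤ) ∈ idealOf ℓ q := Ideal.subset_span (by simp)
  have hqI : (q : MvPolynomial (Fin 3) ℤ) ∈ idealOf ℓ q := Ideal.subset_span (by simp)
  have hmk (p) : Ideal.Quotient.mk (idealOf ℓ q) (φ (restrictHom v w p)) =
      Ideal.Quotient.mk (idealOf ℓ q) p := by
    rw [eq_comm, Ideal.Quotient.mk_eq_mk_iff_sub_mem]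
    exact Ideal.mem_of_dvd _ (hφℓ p) hℓI
  refine nonempty_quadraticAlgebra_ringEquiv_global (quotGrading Form (idealOf ℓ q))
    ((Ideal.Quotient.mk (idealOf ℓ q)).comp φ.toRingHom) hQ (fun n f => ⟨?_, ?_⟩)
    fun F => ⟨fun hF => ?_, ?_⟩
  · rintro ⟨p, hp, rfl⟩
    exact ⟨restrictHom v w p, restrictHom_isHomogeneous v w hp, hmk p⟩
  · rintro ⟨F, hF, rfl⟩
    exact ⟨φ F, hφh n F hF, rfl⟩
  -- Restriction kills ℓ, sends `q` to Q and undoes `φ`, so it carries membership in (ℓ, q) to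
  -- divisibility by Q.
  · have hF' : φ F ∈ idealOf ℓ q := Ideal.Quotient.eq_zero_iff_mem.mp hF
    obtain ⟨x, y, hxy⟩ := Ideal.mem_span_pair.mp hF'
    have := congrArg (restrictHom v w) hxy
    rw [map_add, map_mul, map_mul, h.restrictHom_eq_zero, hφ, hq, mul_zero, zero_add] at this
    exact ⟨_, by rw [← this, mul_comm]⟩
  · rintro ⟨G, rfl⟩
    have h0 := hmk q
    rw [Ideal.Quotient.eq_zero_iff_mem.mpr hqI, hq] at h0
    change Ideal.Quotient.mk (idealOf ℓ q) (φ (binForm a b c * G)) = 0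
    rw [map_mul, map_mul, h0, zero_mul]

/-- Specializing distinct points in one fibre force positive dimension. -/
lemma eq_of_specializes_of_krullDim_fiber {X Y : Scheme.{0}} (f : X ⟶ Y) (y : Y)
    (hd : topologicalKrullDim (f.fiber y) = 0) {x₀ x₁ : X} (h₀ : f x₀ = y) (h₁ : f x₁ = y)
    (hs : x₀ ⤳ x₁) : x₀ = x₁ := by
  have e := (f.fiberHomeo y).isHomeomorph.topologicalKrullDim_eq
  rw [hd] at e
  have hmax := Order.krullDim_nonpos_iff_forall_isMax.mp e.symm.le
  let z₀ : f ⁻¹' {y} := ⟨x₀, h₀⟩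
  let z₁ : f ⁻¹' {y} := ⟨x₁, h₁⟩
  let c (z : f ⁻¹' {y}) : TopologicalSpace.IrreducibleCloseds (f ⁻¹' {y}) :=
    ⟨closure {z}, isIrreducible_singleton.closure, isClosed_closure⟩
  have hz : z₀ ⤳ z₁ := (subtype_specializes_iff _ _).mpr hs
  have hle : c z₁ ≤ c z₀ := hz.closure_subset
  have hle' : closure {z₀} ⊆ closure {z₁} := hmax (c z₁) hle
  have hz' : z₁ ⤳ z₀ := specializes_iff_closure_subset.mpr hle'
  exact congrArg Subtype.val (hz.antisymm hz').eq

/-- A finite scheme over the integers does not contain a projective line. -/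
lemma restrictHom_ne_zero {ℓ : Form 1} {q : Form 2}
    (hℓ : IsPrimitivePoly ℓ) {v w : Fin 3 → ℤ} (h : IsKernelBasis ℓ v w)
    {Z : Scheme.{0}} {i : Z ⟶ P2} (hZ : IsHilbPoint i) (e : Z ≅ projOf ℓ q) :
    restrictHom v w q ≠ 0 := by
  intro hq
  obtain ⟨φ, hφh, hφ, hφℓ⟩ := h.exists_section hℓ
  -- If Q = 0, then S ↦ 1, T ↦ X defines a map from the affine line over ℚ to Z. Its generic point
  -- and origin lie in the generic fibre, one specializing to the other, so in dimension 0 they have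
  -- the same image. But the function T/S pulls back to X, which vanishes only at the origin.
  let ev : MvPolynomial (Fin 2) ℤ →+* Polynomial ℚ :=
    (aeval ![(1 : Polynomial ℚ), Polynomial.X]).toRingHom
  let χ : MvPolynomial (Fin 3) ℤ ⧸ idealOf ℓ q →+* Polynomial ℚ :=
    Ideal.Quotient.lift _ (ev.comp (restrictHom v w).toRingHom) (by
      intro a ha
      obtain ⟨x, y, rfl⟩ := Ideal.mem_span_pair.mp ha
      change ev (restrictHom v w _) = 0
      rw [map_add, map_mul, map_mul, h.restrictHom_eq_zero, hq]
      simp)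
  let s := Ideal.Quotient.mk (idealOf ℓ q) (φ (X 0))
  let t := Ideal.Quotient.mk (idealOf ℓ q) (φ (X 1))
  have hs : s ∈ quotGrading Form (idealOf ℓ q) 1 := ⟨_, hφh 1 _ (isHomogeneous_X ℤ 0), rfl⟩
  have ht : t ∈ quotGrading Form (idealOf ℓ q) 1 := ⟨_, hφh 1 _ (isHomogeneous_X ℤ 1), rfl⟩
  have hχs : χ s = 1 := by
    change ev (restrictHom v w (φ (X 0))) = 1
    rw [hφ]; simp [ev]
  have hχt : χ t = Polynomial.X := by
    change ev (restrictHom v w (φ (X 1))) = _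
    rw [hφ]; simp [ev]
  let L : Localization.Away s →+* Polynomial ℚ := Localization.awayLift χ s (by simp [hχs])
  let g : HomogeneousLocalization.Away (quotGrading Form (idealOf ℓ q)) s →+* Polynomial ℚ :=
    L.comp (algebraMap _ (Localization.Away s))
  have hg : g (frac _ hs 1 t ht) = Polynomial.X := by
    have := congrArg L (algebraMap_pow_mul_val_frac hs 1 t ht)
    have hL (x) : L (algebraMap _ _ x) = χ x := IsLocalization.lift_eq _ x
    rw [map_mul, map_pow, hL, hL, hχs, hχt, one_pow, one_mul] at this
    exact this
  let j : Spec (CommRingCat.of (Polynomial ℚ)) ⟶ projOf ℓ q :=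
    Spec.map (CommRingCat.ofHom g) ≫ Proj.awayι _ s hs one_pos
  let k := j ≫ e.inv
  let x₀ : Spec (CommRingCat.of (Polynomial ℚ)) :=
    (⟨⊥, Ideal.isPrime_bot⟩ : PrimeSpectrum (Polynomial ℚ))
  let x₁ : Spec (CommRingCat.of (Polynomial ℚ)) :=
    (⟨Ideal.span {Polynomial.X}, (Ideal.span_singleton_prime Polynomial.X_ne_zero).mpr
      Polynomial.prime_X⟩ : PrimeSpectrum (Polynomial ℚ))
  let η : Spec (CommRingCat.of ℤ) := (⟨⊥, Ideal.isPrime_bot⟩ : PrimeSpectrum ℤ)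
  -- Nonzero integers are invertible in ℚ[X], so every point lies over the generic point of Spec ℤ.
  have hgen (x : Spec (CommRingCat.of (Polynomial ℚ))) : specZIsTerminal.from Z (k x) = η := by
    have hk : k ≫ specZIsTerminal.from Z =
        Spec.map (CommRingCat.ofHom (Int.castRingHom (Polynomial ℚ))) :=
      specZIsTerminal.hom_ext _ _
    have : specZIsTerminal.from Z (k x) = (k ≫ specZIsTerminal.from Z) x := rfl
    rw [this, hk]
    refine PrimeSpectrum.ext (le_bot_iff.mp fun n hn => ?_)
    change ((n : ℤ) : Polynomial ℚ) ∈ x.asIdeal at hn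
    by_contra hn0
    have hu : IsUnit ((n : ℤ) : Polynomial ℚ) := by
      rw [← map_intCast (Polynomial.C : ℚ →+* Polynomial ℚ)]
      exact (IsUnit.mk0 _ (Int.cast_ne_zero.mpr hn0)).map Polynomial.C
    exact x.isPrime.ne_top (Ideal.eq_top_of_isUnit_mem _ hn hu)
  have hspec : x₀ ⤳ x₁ := (PrimeSpectrum.le_iff_specializes _ _).mp bot_le
  have hkeq := eq_of_specializes_of_krullDim_fiber _ η (hZ.dim_fiber η) (hgen x₀) (hgen x₁)
    (hspec.map k.continuous)
  have hj : j x₀ = j x₁ := by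
    have : Function.Injective e.inv := e.inv.homeomorph.injective
    exact this hkeq
  have hι : Function.Injective (Proj.awayι (quotGrading Form (idealOf ℓ q)) s hs one_pos) :=
    (Proj.awayι (quotGrading Form (idealOf ℓ q)) s hs one_pos).isOpenEmbedding.injective
  have hc : Spec.map (CommRingCat.ofHom g) x₀ = Spec.map (CommRingCat.ofHom g) x₁ := by
    exact hι hj
  have hm : frac _ hs 1 t ht ∈ (Spec.map (CommRingCat.ofHom g) x₁).asIdeal := by
    change g _ ∈ Ideal.span _
    rw [hg]
    exact Ideal.mem_span_singleton_self _
  rw [← hc] at hm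
  have : g (frac _ hs 1 t ht) ∈ (⊥ : Ideal (Polynomial ℚ)) := hm
  rw [hg] at this
  exact Polynomial.X_ne_zero this

end ProjOf

/-! ### Kernel bases -/

section KernelBases

open MvPolynomial

lemma exists_isKernelBasis {ℓ : Form 1} (hℓ : IsPrimitivePoly ℓ) :
    ∃ v w : Fin 3 → ℤ, IsKernelBasis ℓ v w := by
  obtain ⟨u, hu⟩ := exists_aeval_eq_one hℓ
  obtain ⟨l, hl⟩ := exists_eq_sum_of_form_one ℓ
  let L : (Fin 3 → ℤ) →ₗ[ℤ] ℤ := Fintype.linearCombination ℤ l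
  have hL (x) : L x = aeval x (ℓ : MvPolynomial (Fin 3) ℤ) := by
    rw [hl, aeval_linear, Fintype.linearCombination_apply]
    simp [mul_comm]
  have hsurj : LinearMap.range L = ⊤ := by
    rw [LinearMap.range_eq_top]
    intro n
    exact ⟨n • u, by rw [map_smul, hL, hu]; simp⟩
  have hrank : Module.finrank ℤ (LinearMap.ker L) = 2 := by
    have := (LinearMap.ker L).finrank_quotient_add_finrank
    rw [(L.quotKerEquivOfSurjective (LinearMap.range_eq_top.mp hsurj)).finrank_eq] at this
    simp at this
    omega
  let b := Module.finBasisOfFinrankEq ℤ (LinearMap.ker L) hrank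
  refine ⟨b 0, b 1, ?_, fun x => ?_⟩
  · have := b.linearIndependent.map' (LinearMap.ker L).subtype (Submodule.ker_subtype _)
    have e : ![(b 0 : Fin 3 → ℤ), b 1] = (LinearMap.ker L).subtype ∘ b := by
      ext i; fin_cases i <;> rfl
    rw [e]
    exact this
  · rw [← hL, ← LinearMap.mem_ker, Submodule.mem_span_pair]
    constructor
    · rintro ⟨r, s, rfl⟩
      exact add_mem (Submodule.smul_mem _ _ (b 0).2) (Submodule.smul_mem _ _ (b 1).2)
    · intro hx
      refine ⟨b.repr ⟨x, hx⟩ 0, b.repr ⟨x, hx⟩ 1, ?_⟩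
      have := congrArg Subtype.val (b.sum_repr ⟨x, hx⟩)
      rw [Fin.sum_univ_two] at this
      exact this

/-- The coordinates `σ, τ` are integral linear forms, so the expansion in `v, w` survives any base
change. -/
lemma IsKernelBasis.exists_eq_of_aeval_eq_zero {ℓ : Form 1} (hℓ : IsPrimitivePoly ℓ)
    {v w : Fin 3 → ℤ} (h : IsKernelBasis ℓ v w) {R : Type*} [CommRing R] (x : Fin 3 → R)
    (hx : aeval x (ℓ : MvPolynomial (Fin 3) ℤ) = 0) :
    ∃ α β : R, ∀ i, x i = α * v i + β * w i := by
  obtain ⟨l, u, σ, τ, hl, hστ⟩ := h.exists_dual hℓ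
  have hx' : ∑ j, (l j : R) * x j = 0 := by
    rw [← hx, hl]; simp
  refine ⟨∑ j, σ j * x j, ∑ j, τ j * x j, fun i => ?_⟩
  have : ∑ j, x j * ((σ j * v i + τ j * w i : ℤ) : R) = x i - (∑ j, (l j : R) * x j) * u i := by
    simp only [hστ, Int.cast_sub, Int.cast_mul, mul_sub, Finset.sum_sub_distrib, Finset.sum_mul]
    congr 1
    · simp [Pi.single_apply]
    · exact Finset.sum_congr rfl fun _ _ => by ring
  rw [hx', zero_mul, sub_zero] at this
  rw [← this, Finset.sum_mul, Finset.sum_mul, ← Finset.sum_add_distrib]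
  exact Finset.sum_congr rfl fun _ _ => by push_cast; ring

lemma aeval_eq_of_restrictHom {p : MvPolynomial (Fin 3) ℤ} {v w : Fin 3 → ℤ} {a b c : ℤ}
    (hp : restrictHom v w p = binForm a b c) {R : Type*} [CommRing R] (x : Fin 3 → R) (α β : R)
    (hx : ∀ i, x i = α * v i + β * w i) :
    aeval x p = a * α ^ 2 + b * (α * β) + c * β ^ 2 := by
  have : (aeval x : MvPolynomial (Fin 3) ℤ →ₐ[ℤ] R) = (aeval ![α, β]).comp (restrictHom v w) := by
    refine algHom_ext fun i => ?_
    simp [restrictHom, hx]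
  rw [this, AlgHom.comp_apply, hp]
  simp [binForm]

lemma IsKernelBasis.aeval_eq_zero {ℓ : Form 1} {v w : Fin 3 → ℤ} (h : IsKernelBasis ℓ v w)
    {R : Type*} [CommRing R] (x : Fin 3 → R) (α β : R) (hx : ∀ i, x i = α * v i + β * w i) :
    aeval x (ℓ : MvPolynomial (Fin 3) ℤ) = 0 := by
  rw [aeval_eq_of_restrictHom (a := 0) (b := 0) (c := 0)
    (by rw [h.restrictHom_eq_zero]; simp [binForm]) x α β hx]
  simp

/-- Unimodular change of a kernel basis. -/
lemma IsKernelBasis.change {ℓ : Form 1} (hℓ : IsPrimitivePoly ℓ) {v w : Fin 3 → ℤ}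
    (h : IsKernelBasis ℓ v w) {p q r s : ℤ} (hdet : p * s - q * r = 1) :
    IsKernelBasis ℓ (fun j => p * v j + q * w j) (fun j => r * v j + s * w j) := by
  refine ⟨?_, fun x => ⟨fun hx => ?_, fun hx => ?_⟩⟩
  · rw [LinearIndependent.pair_iff]
    intro y z hyz
    obtain ⟨h1, h2⟩ := h.eq_and_eq (a := y * p + z * r) (b := y * q + z * s) (a' := 0) (b' := 0)
      fun j => by
        have := congrFun hyz j
        simp only [Pi.add_apply, Pi.smul_apply, smul_eq_mul, Pi.zero_apply] at this
        linear_combination this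
    constructor
    · linear_combination s * h1 - r * h2 - y * hdet
    · linear_combination p * h2 - q * h1 - z * hdet
  · obtain ⟨y, z, rfl⟩ := Submodule.mem_span_pair.mp hx
    refine h.aeval_eq_zero _ (y * p + z * r) (y * q + z * s) fun j => ?_
    simp
    ring
  · obtain ⟨α, β, hαβ⟩ := h.exists_eq_of_aeval_eq_zero hℓ x hx
    refine Submodule.mem_span_pair.mpr ⟨s * α - r * β, p * β - q * α, ?_⟩
    ext j
    have := hαβ j
    simp only [Pi.add_apply, Pi.smul_apply, smul_eq_mul, Int.cast_id] at this ⊢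
    rw [this]
    linear_combination (α * v j + β * w j) * hdet

/-- Every vector in the kernel is a multiple of the first member of some kernel basis. -/
lemma IsKernelBasis.exists_eq_smul {ℓ : Form 1} (hℓ : IsPrimitivePoly ℓ) {v w : Fin 3 → ℤ}
    (h : IsKernelBasis ℓ v w) {x : Fin 3 → ℤ} (hx : aeval x (ℓ : MvPolynomial (Fin 3) ℤ) = 0) :
    ∃ (e f : Fin 3 → ℤ) (g : ℤ), IsKernelBasis ℓ e f ∧ ∀ j, x j = g * e j := by
  obtain ⟨α, β, hαβ⟩ := h.exists_eq_of_aeval_eq_zero hℓ x hx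
  -- A zero gcd means x = 0, where g = 0 fits any basis. Otherwise g is the gcd, and Bézout
  -- completes the primitive vector x/g.
  by_cases h0 : Int.gcd α β = 0
  · rw [Int.gcd_eq_zero_iff] at h0
    exact ⟨v, w, 0, h, fun j => by rw [hαβ, h0.1, h0.2]; simp⟩
  · obtain ⟨α', β', hcop, hα, hβ⟩ := Int.exists_gcd_one (Nat.pos_of_ne_zero h0)
    obtain ⟨r, s, hrs⟩ := Int.isCoprime_iff_gcd_eq_one.mpr hcop
    refine ⟨_, _, Int.gcd α β, h.change hℓ (p := α') (q := β') (r := -s) (s := r)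
      (by linear_combination hrs), fun j => ?_⟩
    rw [hαβ]
    simp only [Int.cast_id]
    linear_combination v j * hα + w j * hβ

/-- The cross product of a kernel basis is primitive. -/
lemma IsKernelBasis.isUnit_of_dvd_cross {ℓ : Form 1} (hℓ : IsPrimitivePoly ℓ) {v w : Fin 3 → ℤ}
    (h : IsKernelBasis ℓ v w) {n : ℤ} (h0 : n ∣ v 1 * w 2 - v 2 * w 1)
    (h1 : n ∣ v 2 * w 0 - v 0 * w 2) (h2 : n ∣ v 0 * w 1 - v 1 * w 0) : IsUnit n := by
  obtain ⟨l, u, σ, τ, hl, hστ⟩ := h.exists_dual hℓ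
  let M : Matrix (Fin 3) (Fin 3) ℤ := .of fun i => ![v i, w i, u i]
  let N : Matrix (Fin 3) (Fin 3) ℤ := .of ![σ, τ, l]
  have hMN : M * N = 1 := by
    ext i j
    have := hστ j i
    rw [Matrix.mul_apply, Fin.sum_univ_three, Matrix.one_apply]
    simp only [M, N, Matrix.of_apply, Matrix.cons_val_zero, Matrix.cons_val_one,
      Matrix.cons_val]
    rw [Pi.single_apply] at this
    linear_combination this
  have hdet := congrArg Matrix.det hMN
  rw [Matrix.det_mul, Matrix.det_one] at hdet
  refine isUnit_of_dvd_one (hdet ▸ Dvd.dvd.mul_right ?_ _)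
  -- Expansion along the column `u`: the cofactors are the coordinates of the cross product, and
  -- this determinant divides 1.
  have : M.det = (v 1 * w 2 - v 2 * w 1) * u 0 + (v 2 * w 0 - v 0 * w 2) * u 1 +
      (v 0 * w 1 - v 1 * w 0) * u 2 := by
    rw [Matrix.det_fin_three]
    simp only [M, Matrix.of_apply, Matrix.cons_val_zero, Matrix.cons_val_one,
      Matrix.cons_val]
    ring
  rw [this]
  exact ((h0.mul_right _).add (h1.mul_right _)).add (h2.mul_right _)

/-- If `X₀ ℓ, X₁ ℓ, X₂ ℓ, q` span a primitive lattice, then the restriction of `q` to the line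
`ℓ = 0` is primitive or zero. -/
lemma isUnit_of_dvd_of_isPrimitiveLattice {ℓ : Form 1} {q : Form 2} (hℓ : IsPrimitivePoly ℓ)
    (hΛ : IsPrimitiveLattice (latticeTwo ℓ q)) {v w : Fin 3 → ℤ} (h : IsKernelBasis ℓ v w)
    {a b c : ℤ} (hq : restrictHom v w q = binForm a b c) (hQ : binForm a b c ≠ 0) {n : ℤ}
    (ha : n ∣ a) (hb : n ∣ b) (hc : n ∣ c) : IsUnit n := by
  obtain ⟨a', rfl⟩ := ha
  obtain ⟨b', rfl⟩ := hb
  obtain ⟨c', rfl⟩ := hc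
  obtain ⟨φ, hφh, hφ, hφℓ⟩ := h.exists_section hℓ
  have hQn : binForm (n * a') (n * b') (n * c') = n • binForm a' b' c' := by
    rw [binForm, binForm, smul_eq_C_mul, C_mul, C_mul, C_mul]; ring
  have hn : n ≠ 0 := fun h0 => hQ (by rw [hQn, h0, zero_smul])
  have hQ' : binForm a' b' c' ≠ 0 := fun h0 => hQ (by rw [hQn, h0, smul_zero])
  obtain ⟨r, hr⟩ := hφℓ q
  have hhom : ((q : MvPolynomial (Fin 3) ℤ) - φ (restrictHom v w q)).IsHomogeneous (1 + 1) :=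
    IsHomogeneous.sub q.2 (hφh 2 _ (restrictHom_isHomogeneous v w q.2))
  have hr' := homogeneousComponent_eq_self hhom
  rw [hr, homogeneousComponent_mul_of_left ℓ.2, ← hr] at hr'
  obtain ⟨m, hm⟩ := exists_eq_sum_of_form_one ⟨homogeneousComponent 1 r,
    homogeneousComponent_mem 1 r⟩
  simp only at hm
  -- φ(Q) differs from `q` by a linear form times ℓ, so it lies in the lattice, and Q = nQ'.
  -- Primitivity puts φ(Q') in the lattice as well; restricting to the line gives Q' = kQ = knQ',
  -- whence kn = 1.
  have hmem : n • φ (binForm a' b' c') ∈ latticeTwo ℓ q := by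
    rw [← map_smul, ← hQn, ← hq, show φ (restrictHom v w q) = (q : MvPolynomial (Fin 3) ℤ) -
      (m 0 • (X 0 * (ℓ : MvPolynomial (Fin 3) ℤ)) + m 1 • (X 1 * (ℓ : MvPolynomial (Fin 3) ℤ)) +
        m 2 • (X 2 * (ℓ : MvPolynomial (Fin 3) ℤ))) by
      rw [hm, Fin.sum_univ_three] at hr'
      simp only [smul_eq_C_mul]
      linear_combination hr']
    refine sub_mem (Submodule.subset_span (by simp)) (add_mem (add_mem ?_ ?_) ?_) <;>
      exact Submodule.smul_mem _ _ (Submodule.subset_span (by simp))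
  have hk (x) (hx : x ∈ latticeTwo ℓ q) : ∃ k : ℤ, restrictHom v w x = k • restrictHom v w q := by
    induction hx using Submodule.span_induction with
    | mem x hx =>
      simp only [Set.mem_insert_iff, Set.mem_singleton_iff] at hx
      rcases hx with rfl | rfl | rfl | rfl
      · exact ⟨0, by rw [map_mul, h.restrictHom_eq_zero]; simp⟩
      · exact ⟨0, by rw [map_mul, h.restrictHom_eq_zero]; simp⟩
      · exact ⟨0, by rw [map_mul, h.restrictHom_eq_zero]; simp⟩
      · exact ⟨1, by simp⟩
    | zero => exact ⟨0, by simp⟩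
    | add x y _ _ hx hy =>
      obtain ⟨k, hk⟩ := hx
      obtain ⟨l, hl⟩ := hy
      exact ⟨k + l, by rw [map_add, hk, hl, add_smul]⟩
    | smul z x _ hx =>
      obtain ⟨k, hk⟩ := hx
      exact ⟨z * k, by rw [map_smul, hk, mul_smul]⟩
  obtain ⟨k, hk⟩ := hk _ (hΛ _ n hn hmem)
  rw [hφ, hq, hQn, smul_smul] at hk
  have : (k * n - 1) • binForm a' b' c' = 0 := by rw [sub_smul, ← hk, one_smul, sub_self]
  rcases smul_eq_zero.mp this with h1 | h1
  · exact IsUnit.of_mul_eq_one k (by linear_combination h1)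
  · exact absurd h1 hQ'

end KernelBases

/-! ### Greatest common divisors of three integers -/

lemma gcd3_mul (k a b c : ℤ) : gcd3 (k * a) (k * b) (k * c) = |k| * gcd3 a b c := by
  simp only [gcd3, Int.gcd_mul_left, Int.abs_eq_natAbs]
  push_cast
  rcases abs_choice k with h | h
  · rw [h, Int.gcd_mul_left]
    push_cast
    rw [h]
  · rw [h, neg_mul, Int.gcd_neg, Int.gcd_mul_left]
    push_cast
    rw [h]

lemma gcd3_eq_one {a b c : ℤ} (h : ∀ n : ℤ, n ∣ a → n ∣ b → n ∣ c → IsUnit n) :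
    gcd3 a b c = 1 := by
  have hbc : gcd3 a b c ∣ (Int.gcd b c : ℤ) := Int.gcd_dvd_right _ _
  have hu := h (gcd3 a b c) (Int.gcd_dvd_left _ _) (hbc.trans (Int.gcd_dvd_left _ _))
    (hbc.trans (Int.gcd_dvd_right _ _))
  rcases Int.isUnit_iff.mp hu with h1 | h1
  · exact h1
  · have : 0 ≤ gcd3 a b c := Int.natCast_nonneg _
    omega

lemma gcd3_neg (a b c : ℤ) : gcd3 a (-b) (-c) = gcd3 a b c := by
  simp [gcd3, Int.gcd_neg, Int.neg_gcd]

lemma gcd3_dvd_left (a b c : ℤ) : gcd3 a b c ∣ a := Int.gcd_dvd_left _ _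

/-! ### Rational zeros -/

section RationalZeros

open MvPolynomial

/-- A nonzero binary quadratic form over `ℚ` with a zero has at most one other zero. -/
lemma exists_linear_factor {a b c : ℚ} (hne : ¬ (a = 0 ∧ b = 0 ∧ c = 0)) {α₀ β₀ : ℚ}
    (h0 : ¬ (α₀ = 0 ∧ β₀ = 0)) (hz : a * α₀ ^ 2 + b * (α₀ * β₀) + c * β₀ ^ 2 = 0) :
    ∃ r s : ℚ, ¬ (r = 0 ∧ s = 0) ∧ ∀ α β : ℚ, a * α ^ 2 + b * (α * β) + c * β ^ 2 = 0 →
      β₀ * α - α₀ * β = 0 ∨ r * α + s * β = 0 := by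
  by_cases hβ : β₀ = 0
  · subst hβ
    have hα : α₀ ≠ 0 := fun h => h0 ⟨h, rfl⟩
    have ha : a = 0 := by
      have : a * α₀ ^ 2 = 0 := by linear_combination hz
      simpa [hα] using this
    subst ha
    refine ⟨b, c, fun h => hne ⟨rfl, h⟩, fun α β h => ?_⟩
    have : β * (b * α + c * β) = 0 := by linear_combination h
    rcases mul_eq_zero.mp this with h | h
    · exact Or.inl (by rw [h]; ring)
    · exact Or.inr h
  -- These are the coefficients of the quotient of β₀²Q by the linear form β₀α - α₀β, which vanishes
  -- at the known zero.
  · refine ⟨a * β₀, a * α₀ + b * β₀, fun h => hne ?_, fun α β h => ?_⟩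
    · obtain ⟨h1, h2⟩ := h
      have ha : a = 0 := by simpa [hβ] using h1
      subst ha
      have hb : b = 0 := by simpa [hβ] using h2
      subst hb
      have hc : c * β₀ ^ 2 = 0 := by linear_combination hz
      exact ⟨rfl, rfl, by simpa [hβ] using hc⟩
    · have : (β₀ * α - α₀ * β) * (a * β₀ * α + (a * α₀ + b * β₀) * β) = 0 := by
        linear_combination β₀ ^ 2 * h - β ^ 2 * hz
      exact mul_eq_zero.mp this

lemma exists_smul_of_linear_eq_zero {r s : ℚ} (h : ¬ (r = 0 ∧ s = 0)) {α β α₁ β₁ : ℚ}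
    (h₁ : ¬ (α₁ = 0 ∧ β₁ = 0)) (e : r * α + s * β = 0) (e₁ : r * α₁ + s * β₁ = 0) :
    ∃ k : ℚ, α = k * α₁ ∧ β = k * β₁ := by
  have hdet : α * β₁ = α₁ * β := by
    by_cases hr : r = 0
    · have hs : s ≠ 0 := fun hs => h ⟨hr, hs⟩
      apply mul_left_cancel₀ hs
      linear_combination α * e₁ - α₁ * e
    · apply mul_left_cancel₀ hr
      linear_combination β₁ * e - β * e₁
  by_cases hα : α₁ = 0
  · have hβ : β₁ ≠ 0 := fun hβ => h₁ ⟨hα, hβ⟩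
    refine ⟨β / β₁, ?_, by field_simp⟩
    rw [hα, zero_mul] at hdet
    rw [hα, mul_zero]
    simpa [hβ] using hdet
  · refine ⟨α / α₁, by field_simp, ?_⟩
    field_simp
    linear_combination -hdet

/-- `rationalPoints` tests only the chosen representative `p.rep`; homogeneity passes between it and
any other. -/
lemma IsSolution.smul {ℓ : Form 1} {q : Form 2} {x : Fin 3 → ℚ} (hx : IsSolution ℓ q x)
    (k : ℚ) : IsSolution ℓ q (k • x) := by
  have h (n : ℕ) (p : MvPolynomial (Fin 3) ℤ) (hp : p.IsHomogeneous n) :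
      aeval (k • x) p = k ^ n * aeval x p := by
    rw [aeval_def, aeval_def, eval₂_eq', eval₂_eq', Finset.mul_sum]
    refine Finset.sum_congr rfl fun d hd => ?_
    have hdeg : d 0 + d 1 + d 2 = n := by
      have := hp.degree_eq_sum_deg_support hd
      rw [this, Finset.sum_subset (Finset.subset_univ _) (by simp), Fin.sum_univ_three]
    simp only [Fin.prod_univ_three, Pi.smul_apply, smul_eq_mul, mul_pow, ← hdeg, pow_add]
    ring
  exact ⟨by rw [h 1 _ ℓ.2, hx.1, mul_zero], by rw [h 2 _ q.2, hx.2, mul_zero]⟩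

/-- In the nonsplit case there are no rational solutions. -/
lemma IsNonsplit.eq_zero_of_isSolution {ℓ : Form 1} {q : Form 2} (hns : IsNonsplit ℓ q)
    (hℓ : IsPrimitivePoly ℓ) {v w : Fin 3 → ℤ} (h : IsKernelBasis ℓ v w) {a b c : ℤ}
    (hq : restrictHom v w q = binForm a b c) (hQ : binForm a b c ≠ 0) {x : Fin 3 → ℚ}
    (hx : IsSolution ℓ q x) : x = 0 := by
  by_contra hx0
  have hne : ¬ ((a : ℚ) = 0 ∧ (b : ℚ) = 0 ∧ (c : ℚ) = 0) := fun h0 => hQ (by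
    simp only [Int.cast_eq_zero] at h0
    simp [binForm, h0])
  have coords (y : Fin 3 → ℚ) (hy : IsSolution ℓ q y) : ∃ α β : ℚ,
      (∀ i, y i = α * v i + β * w i) ∧ a * α ^ 2 + b * (α * β) + c * β ^ 2 = 0 := by
    obtain ⟨α, β, hαβ⟩ := h.exists_eq_of_aeval_eq_zero hℓ y hy.1
    exact ⟨α, β, hαβ, by rw [← aeval_eq_of_restrictHom hq y α β hαβ, hy.2]⟩
  obtain ⟨α₀, β₀, hx₀, hz₀⟩ := coords x hx
  have h0 : ¬ (α₀ = 0 ∧ β₀ = 0) := fun h0 => hx0 (by ext i; rw [hx₀, h0.1, h0.2]; simp)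
  -- One rational zero splits off a rational linear factor, and the other factor has exactly one
  -- zero up to scaling. So there would be one or two rational points.
  obtain ⟨r, s, hrs, hfac⟩ := exists_linear_factor hne h0 hz₀
  let p₀ := Projectivization.mk ℚ x hx0
  have hp₀ : p₀ ∈ rationalPoints ℓ q := by
    obtain ⟨k, hk⟩ := Projectivization.exists_smul_eq_mk_rep ℚ x hx0
    change IsSolution ℓ q p₀.rep
    rw [← hk]
    exact hx.smul (k : ℚ)
  have hother (p) (hp : p ∈ rationalPoints ℓ q) (hpne : p ≠ p₀) : ∃ α β : ℚ,
      (∀ i, p.rep i = α * v i + β * w i) ∧ ¬ (α = 0 ∧ β = 0) ∧ r * α + s * β = 0 := by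
    obtain ⟨α, β, hr, hz⟩ := coords p.rep hp
    refine ⟨α, β, hr, fun hn => p.rep_nonzero (by ext i; rw [hr, hn.1, hn.2]; simp), ?_⟩
    refine (hfac α β hz).resolve_left fun h1 => hpne ?_
    obtain ⟨k, hk₁, hk₂⟩ := exists_smul_of_linear_eq_zero (r := β₀) (s := -α₀)
      (fun h => h0 ⟨by simpa using h.2, h.1⟩) h0 (α := α) (β := β)
      (by linear_combination h1) (by ring)
    rw [← p.mk_rep, Projectivization.mk_eq_mk_iff']
    refine ⟨k, ?_⟩
    ext i
    rw [Pi.smul_apply, hr, hx₀, hk₁, hk₂, smul_eq_mul]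
    ring
  by_cases hex : ∃ p₁ ∈ rationalPoints ℓ q, p₁ ≠ p₀
  · obtain ⟨p₁, hp₁, hne₁⟩ := hex
    refine hns.2 ?_
    rw [Set.encard_eq_two]
    refine ⟨p₀, p₁, hne₁.symm, Set.Subset.antisymm (fun p hp => ?_) ?_⟩
    · rw [Set.mem_insert_iff, Set.mem_singleton_iff, or_iff_not_imp_left]
      intro hpne
      obtain ⟨α, β, hr, -, he⟩ := hother p hp hpne
      obtain ⟨α₁, β₁, hr₁, hn₁, he₁⟩ := hother p₁ hp₁ hne₁
      obtain ⟨k, hk₁, hk₂⟩ := exists_smul_of_linear_eq_zero hrs hn₁ he he₁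
      rw [← p.mk_rep, ← p₁.mk_rep, Projectivization.mk_eq_mk_iff']
      refine ⟨k, ?_⟩
      ext i
      rw [Pi.smul_apply, hr, hr₁, hk₁, hk₂, smul_eq_mul]
      ring
    · rintro p (rfl | rfl)
      · exact hp₀
      · exact hp₁
  · push Not at hex
    refine hns.1 ?_
    rw [Set.encard_eq_one]
    exact ⟨p₀, Set.Subset.antisymm (fun p hp => hex p hp) (by rintro p rfl; exact hp₀)⟩

lemma IsNonsplit.eq_zero_of_form_eq_zero {ℓ : Form 1} {q : Form 2} (hns : IsNonsplit ℓ q)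
    (hℓ : IsPrimitivePoly ℓ) {v w : Fin 3 → ℤ} (h : IsKernelBasis ℓ v w) {a b c : ℤ}
    (hq : restrictHom v w q = binForm a b c) (hQ : binForm a b c ≠ 0) {x y : ℤ}
    (hxy : a * x ^ 2 + b * (x * y) + c * y ^ 2 = 0) : x = 0 ∧ y = 0 := by
  have hsol : IsSolution ℓ q (fun i => (x : ℚ) * v i + y * w i) := by
    refine ⟨h.aeval_eq_zero _ x y fun _ => rfl, ?_⟩
    rw [aeval_eq_of_restrictHom hq _ (x : ℚ) y fun _ => rfl]
    exact_mod_cast hxy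
  have h0 := hns.eq_zero_of_isSolution hℓ h hq hQ hsol
  refine h.eq_and_eq fun j => ?_
  have := congrFun h0 j
  simp only [Pi.zero_apply] at this
  have h1 : x * v j + y * w j = 0 := by exact_mod_cast this
  rw [h1]; ring

end RationalZeros

/-! ### The ring of functions -/

section Functions

variable {ℓ : Form 1} {q : Form 2} {Z : Scheme.{0}} {i : Z ⟶ P2}

lemma binForm_ne_zero (hℓ : IsPrimitivePoly ℓ) (hZ : IsHilbPoint i) (hdef : IsDefinedBy ℓ q i)
    {v w : Fin 3 → ℤ} (h : IsKernelBasis ℓ v w) {a b c : ℤ}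
    (hq : restrictHom v w q = binForm a b c) : binForm a b c ≠ 0 := by
  obtain ⟨e, -⟩ := hdef
  rw [← hq]
  exact restrictHom_ne_zero hℓ h hZ e

lemma isQuadraticOrder_global (hℓ : IsPrimitivePoly ℓ) (hZ : IsHilbPoint i)
    (hdef : IsDefinedBy ℓ q i) {v w : Fin 3 → ℤ} (h : IsKernelBasis ℓ v w) {a b c : ℤ}
    (hq : restrictHom v w q = binForm a b c) :
    IsQuadraticOrder Γ(Z, ⊤) (b ^ 2 - 4 * a * c) := by
  have hQ := binForm_ne_zero hℓ hZ hdef h hq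
  obtain ⟨e, -⟩ := hdef
  obtain ⟨f⟩ := nonempty_quadraticAlgebra_ringEquiv_projOf hℓ h hq hQ
  have := isQuadraticOrder_of_ringEquiv (f.trans (Scheme.Γ.mapIso e.op).commRingCatIsoToRingEquiv)
  rwa [show (-b) ^ 2 + 4 * (-(a * c)) = b ^ 2 - 4 * a * c by ring] at this

lemma exists_restrictHom_eq_binForm (q : Form 2) (v w : Fin 3 → ℤ) :
    ∃ a b c, restrictHom v w q = binForm a b c :=
  ⟨_, _, _, eq_binForm_of_isHomogeneous (restrictHom_isHomogeneous v w q.2)⟩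

lemma IsQuadraticOrder.nonempty_ringEquiv_of_eq {A B : Type*} [CommRing A] [CommRing B] {D : ℤ}
    (hA : IsQuadraticOrder A D) (hB : IsQuadraticOrder B D) : Nonempty (A ≃+* B) := by
  obtain ⟨θ, p, q, hθ, hb⟩ := hA.exists_bijective
  obtain ⟨e⟩ := ringEquiv_of_bijective hθ hb
  obtain rfl := hA.unique (isQuadraticOrder_of_ringEquiv e)
  obtain ⟨f⟩ := hB.nonempty_ringEquiv
  exact ⟨e.symm.trans f⟩

/-- The discriminant in the split case. -/
lemma isQuadraticOrder_global_of_solutions (hℓ : IsPrimitivePoly ℓ)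
    (hΛ : IsPrimitiveLattice (latticeTwo ℓ q)) (hZ : IsHilbPoint i) (hdef : IsDefinedBy ℓ q i)
    {v w : Fin 3 → ℤ} (hv : IsPrimitiveVec v) (hw : IsPrimitiveVec w)
    (hvw : LinearIndependent ℤ ![v, w]) (hsv : IsSolution ℓ q v) (hsw : IsSolution ℓ q w) :
    IsQuadraticOrder Γ(Z, ⊤) (gcd3 (v 1 * w 2 - v 2 * w 1) (v 2 * w 0 - v 0 * w 2)
      (v 0 * w 1 - v 1 * w 0) ^ 2) := by
  obtain ⟨e₀, f₀, h₀⟩ := exists_isKernelBasis hℓ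
  obtain ⟨e, f, g, h, hg⟩ := h₀.exists_eq_smul hℓ hsv.1
  have hgu : IsUnit g := hv g fun j => ⟨e j, hg j⟩
  obtain ⟨α, β, hαβ⟩ := h.exists_eq_of_aeval_eq_zero hℓ w hsw.1
  simp only [Int.cast_id] at hαβ
  obtain ⟨a, b, c, hq⟩ := exists_restrictHom_eq_binForm q e f
  have hQ := binForm_ne_zero hℓ hZ hdef h hq
  -- Primitivity of `v` makes g = ±1, so the first basis vector `e` is itself a zero of `q`.
  have ha : a = 0 := by
    have := aeval_eq_of_restrictHom hq v g 0 (fun j => by simp [hg])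
    rw [hsv.2] at this
    simpa [hgu.ne_zero] using this.symm
  subst ha
  have hβ : β ≠ 0 := by
    rintro rfl
    rw [LinearIndependent.pair_iff] at hvw
    obtain ⟨h1, h2⟩ := hvw α (-g) (by
      ext j
      simp only [Pi.add_apply, Pi.smul_apply, smul_eq_mul, Pi.zero_apply, hg, hαβ]
      ring)
    exact hgu.ne_zero (by linarith)
  have hlin : b * α + c * β = 0 := by
    have := aeval_eq_of_restrictHom hq w α β (fun j => by simp [hαβ])
    rw [hsw.2] at this
    simp only [Int.cast_id, Int.cast_zero] at this
    apply mul_left_cancel₀ hβ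
    linear_combination -this
  have hcop : IsCoprime β α := by
    rw [Int.isCoprime_iff_gcd_eq_one]
    have := hw (Int.gcd β α) fun j => by
      rw [hαβ]
      exact ((Int.gcd_dvd_right _ _).mul_right _).add ((Int.gcd_dvd_left _ _).mul_right _)
    simpa using Int.isUnit_iff_natAbs_eq.mp this
  -- Q = T(bS + cT) vanishes at the coprime pair (α, β), so Q = kT(βS - αT), where k is ±1 because Q
  -- has content 1.
  obtain ⟨k, rfl⟩ : β ∣ b := by
    refine hcop.dvd_of_dvd_mul_right ⟨-c, by linear_combination hlin⟩
  have hc : c = -(α * k) := by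
    apply mul_left_cancel₀ hβ
    linear_combination hlin
  subst hc
  have hk : IsUnit k := isUnit_of_dvd_of_isPrimitiveLattice hℓ hΛ h hq hQ (dvd_zero _)
    (dvd_mul_left _ _) (dvd_neg.mpr (dvd_mul_left _ _))
  have hcross : gcd3 (e 1 * f 2 - e 2 * f 1) (e 2 * f 0 - e 0 * f 2) (e 0 * f 1 - e 1 * f 0) = 1 :=
    gcd3_eq_one fun n h0 h1 h2 => h.isUnit_of_dvd_cross hℓ h0 h1 h2
  have := isQuadraticOrder_global hℓ hZ hdef h hq
  convert this using 1
  rw [hg, hg, hg, hαβ, hαβ, hαβ,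
    show g * e 1 * (α * e 2 + β * f 2) - g * e 2 * (α * e 1 + β * f 1) =
      (g * β) * (e 1 * f 2 - e 2 * f 1) by ring,
    show g * e 2 * (α * e 0 + β * f 0) - g * e 0 * (α * e 2 + β * f 2) =
      (g * β) * (e 2 * f 0 - e 0 * f 2) by ring,
    show g * e 0 * (α * e 1 + β * f 1) - g * e 1 * (α * e 0 + β * f 0) =
      (g * β) * (e 0 * f 1 - e 1 * f 0) by ring, gcd3_mul, hcross, mul_one, sq_abs]
  have hg2 : g ^ 2 = 1 := by rcases Int.isUnit_iff.mp hgu with rfl | rfl <;> rfl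
  have hk2 : k ^ 2 = 1 := by rcases Int.isUnit_iff.mp hk with rfl | rfl <;> rfl
  linear_combination β ^ 2 * hg2 - β ^ 2 * hk2

end Functions

/-! ### The nonsplit case -/

section Nonsplit

open MvPolynomial

variable {ℓ : Form 1} {q : Form 2}

lemma aeval_re_eq_zero_and_aeval_im_eq_zero {D : ℤ} {v : Fin 3 → ℤ√D}
    (hv : aeval v (ℓ : MvPolynomial (Fin 3) ℤ) = 0) :
    aeval (fun j => (v j).re) (ℓ : MvPolynomial (Fin 3) ℤ) = 0 ∧
      aeval (fun j => (v j).im) (ℓ : MvPolynomial (Fin 3) ℤ) = 0 := by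
  obtain ⟨l, hl⟩ := exists_eq_sum_of_form_one ℓ
  have hv' : ∑ j, (l j : ℤ√D) * v j = 0 := by rw [← hv, hl]; simp
  rw [Fin.sum_univ_three] at hv'
  rw [hl, aeval_linear, aeval_linear, Fin.sum_univ_three, Fin.sum_univ_three]
  have h1 := congrArg Zsqrtd.re hv'
  have h2 := congrArg Zsqrtd.im hv'
  simp at h1 h2
  exact ⟨h1, h2⟩

/-- The discriminant in the nonsplit case, for a binary form without rational zeros. -/
lemma nonsplit_disc {a b c D g α β : ℤ} (hD : D = b ^ 2 - 4 * a * c)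
    (hprim : ∀ n : ℤ, n ∣ a → n ∣ b → n ∣ c → IsUnit n)
    (hnz : ∀ x y : ℤ, a * x ^ 2 + b * (x * y) + c * y ^ 2 = 0 → x = 0 ∧ y = 0)
    (hne : ¬ (g = 0 ∧ α = 0 ∧ β = 0))
    (hz : (a : ℤ√D) * ⟨g, α⟩ ^ 2 + b * (⟨g, α⟩ * ⟨0, β⟩) + c * ⟨0, β⟩ ^ 2 = 0) :
    gcd3 (β ^ 2 * D) (2 * α * β * D) (g ^ 2 - α ^ 2 * D) ≠ 0 ∧
      (D : ℚ) = 4 * β ^ 2 * g ^ 2 * D /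
        (gcd3 (β ^ 2 * D) (2 * α * β * D) (g ^ 2 - α ^ 2 * D) : ℚ) ^ 2 := by
  have ha : a ≠ 0 := by
    rintro rfl
    exact one_ne_zero (hnz 1 0 (by ring)).1
  have hD0 : D ≠ 0 := by
    intro h0
    -- The value of the form at (-b, 2a) is -aD, so D = 0 would produce a double rational zero.
    have := (hnz (-b) (2 * a) (by linear_combination a * (hD - h0))).2
    exact ha (by linarith)
  have hre := congrArg Zsqrtd.re hz
  have him := congrArg Zsqrtd.im hz
  simp [sq] at hre him
  -- For g = 0 the real part of the equation is D times the value of the form at (α, β).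
  have hg : g ≠ 0 := by
    rintro rfl
    obtain ⟨h1, h2⟩ := hnz α β (by
      apply mul_left_cancel₀ hD0
      linear_combination hre)
    exact hne ⟨rfl, h1, h2⟩
  have hb : b * β = -(2 * a * α) := by
    apply mul_left_cancel₀ hg
    linear_combination him
  have hβ : β ≠ 0 := by
    rintro rfl
    have hα : α = 0 := by
      have : a * α = 0 := by linarith
      simpa [ha] using this
    subst hα
    exact hg (hnz g 0 (by linear_combination hre)).1
  have hc : c * (β ^ 2 * D) = a * (α ^ 2 * D - g ^ 2) := by
    linear_combination hre - α * D * hb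
  set G := gcd3 (β ^ 2 * D) (2 * α * β * D) (g ^ 2 - α ^ 2 * D) with hG
  have hP : β ^ 2 * D ≠ 0 := mul_ne_zero (pow_ne_zero _ hβ) hD0
  have hG0 : G ≠ 0 := fun h0 => hP (by
    have := gcd3_dvd_left (β ^ 2 * D) (2 * α * β * D) (g ^ 2 - α ^ 2 * D)
    rw [← hG, h0] at this
    exact zero_dvd_iff.mp this)
  -- The triples (a, b, c) and (β²D, -2αβD, α²D - g²) are proportional and the first has gcd 1, so
  -- cross-multiplying and comparing gcds gives the ratio up to sign.
  have hscale : |a| * G = |β ^ 2 * D| := by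
    rw [hG, ← gcd3_mul, ← mul_one |β ^ 2 * D|, ← gcd3_eq_one hprim, ← gcd3_mul, ← gcd3_neg]
    congr 1
    · ring
    · linear_combination -β * D * hb
    · linear_combination -hc
  have hsq : a ^ 2 * G ^ 2 = (β ^ 2 * D) ^ 2 := by
    rw [← sq_abs a, ← sq_abs (β ^ 2 * D), ← hscale]; ring
  -- The second triple has discriminant 4β²g²D, and discriminants scale by the square of the ratio.
  have hfin : D * G ^ 2 = 4 * β ^ 2 * g ^ 2 * D := by
    apply mul_left_cancel₀ (pow_ne_zero 2 ha)
    have e1 : (β ^ 2 * D) ^ 2 * (b ^ 2 - 4 * a * c) = a ^ 2 * (4 * β ^ 2 * g ^ 2 * D) := by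
      linear_combination (β ^ 2 * D ^ 2) * (b * β - 2 * a * α) * hb - 4 * a * β ^ 2 * D * hc
    rw [← e1, ← hD]
    linear_combination D * hsq
  refine ⟨hG0, ?_⟩
  have hGQ : (G : ℚ) ≠ 0 := by exact_mod_cast hG0
  rw [eq_div_iff (pow_ne_zero 2 hGQ)]
  exact_mod_cast hfin

end Nonsplit
end HilbTwo

theorem mainTheorem10 (ℓ : HilbTwo.Form 1) (q : HilbTwo.Form 2)
    (hℓ : HilbTwo.IsPrimitivePoly ℓ)
    (hΛ : HilbTwo.IsPrimitiveLattice (HilbTwo.latticeTwo ℓ q))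
    (Z : AlgebraicGeometry.Scheme.{0}) (i : Z ⟶ HilbTwo.P2)
    (hZ : HilbTwo.IsHilbPoint i) (hdef : HilbTwo.IsDefinedBy ℓ q i) :
    -- the ring of functions is the unique quadratic order with the discriminant of `q(Sv + Tw)`
    (∀ v w : Fin 3 → ℤ, HilbTwo.IsKernelBasis ℓ v w →
      HilbTwo.IsQuadraticOrder Γ(Z, ⊤) (HilbTwo.binaryDisc (HilbTwo.restrictForm q v w)) ∧
      ∀ (B : Type*) [CommRing B],
        HilbTwo.IsQuadraticOrder B (HilbTwo.binaryDisc (HilbTwo.restrictForm q v w)) →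
        Nonempty (Γ(Z, ⊤) ≃+* B)) ∧
    -- the split case
    (HilbTwo.IsSplit ℓ q → ∀ v w : Fin 3 → ℤ,
      HilbTwo.IsPrimitiveVec v → HilbTwo.IsPrimitiveVec w → LinearIndependent ℤ ![v, w] →
      HilbTwo.IsSolution ℓ q v → HilbTwo.IsSolution ℓ q w →
      HilbTwo.IsQuadraticOrder Γ(Z, ⊤)
        (HilbTwo.gcd3 (v 1 * w 2 - v 2 * w 1) (v 2 * w 0 - v 0 * w 2)
          (v 0 * w 1 - v 1 * w 0) ^ 2)) ∧
    -- the nonsplit case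
    (HilbTwo.IsNonsplit ℓ q → ∀ D : ℤ, HilbTwo.IsQuadraticOrder Γ(Z, ⊤) D →
      ∀ v : Fin 3 → ℤ√D, v ≠ 0 → HilbTwo.IsSolution ℓ q v →
      (∃ (e f : Fin 3 → ℤ) (g α β : ℤ), HilbTwo.IsKernelBasis ℓ e f ∧
        (∀ j, (v j).re = g * e j) ∧ ∀ j, (v j).im = α * e j + β * f j) ∧
      ∀ (e f : Fin 3 → ℤ) (g α β : ℤ), HilbTwo.IsKernelBasis ℓ e f →
        (∀ j, (v j).re = g * e j) → (∀ j, (v j).im = α * e j + β * f j) →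
        HilbTwo.gcd3 (β ^ 2 * D) (2 * α * β * D) (g ^ 2 - α ^ 2 * D) ≠ 0 ∧
        (D : ℚ) = 4 * β ^ 2 * g ^ 2 * D /
          (HilbTwo.gcd3 (β ^ 2 * D) (2 * α * β * D) (g ^ 2 - α ^ 2 * D) : ℚ) ^ 2) := by
  refine ⟨fun v w h => ?_, fun _ v w hv hw hvw hsv hsw => ?_, fun hns D hD v hv hsol => ⟨?_, ?_⟩⟩
  · have hA : HilbTwo.IsQuadraticOrder Γ(Z, ⊤)
        (HilbTwo.binaryDisc (HilbTwo.restrictForm q v w)) :=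
      -- `binaryDisc` and `restrictForm` unfold to b² - 4ac and `restrictHom`, with a, b, c read off
      -- as coefficients.
      HilbTwo.isQuadraticOrder_global hℓ hZ hdef h
        (HilbTwo.eq_binForm_of_isHomogeneous (HilbTwo.restrictHom_isHomogeneous v w q.2))
    exact ⟨hA, fun B _ hB => hA.nonempty_ringEquiv_of_eq hB⟩
  · exact HilbTwo.isQuadraticOrder_global_of_solutions hℓ hΛ hZ hdef hv hw hvw hsv hsw
  · obtain ⟨hre, him⟩ := HilbTwo.aeval_re_eq_zero_and_aeval_im_eq_zero hsol.1
    obtain ⟨e₀, f₀, h₀⟩ := HilbTwo.exists_isKernelBasis hℓ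
    obtain ⟨e, f, g, h, hg⟩ := h₀.exists_eq_smul hℓ hre
    obtain ⟨α, β, hαβ⟩ := h.exists_eq_of_aeval_eq_zero hℓ _ him
    exact ⟨e, f, g, α, β, h, hg, fun j => by simpa using hαβ j⟩
  · intro e f g α β h hg hαβ
    obtain ⟨a, b, c, hq⟩ := HilbTwo.exists_restrictHom_eq_binForm q e f
    have hQ := HilbTwo.binForm_ne_zero hℓ hZ hdef h hq
    have hDe := hD.unique (HilbTwo.isQuadraticOrder_global hℓ hZ hdef h hq)
    refine HilbTwo.nonsplit_disc hDe
      (fun n => HilbTwo.isUnit_of_dvd_of_isPrimitiveLattice hℓ hΛ h hq hQ)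
      (fun x y => hns.eq_zero_of_form_eq_zero hℓ h hq hQ) (fun h0 => hv ?_) ?_
    · ext j
      · simp [hg, h0.1]
      · simp [hαβ, h0.2.1, h0.2.2]
    -- In the basis `e, f` the solution has coordinates g + α√D and β√D.
    · rw [← HilbTwo.aeval_eq_of_restrictHom hq v _ _ (fun j => ?_), hsol.2]
      ext
      · simp [hg]
      · simp [hαβ]
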